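/- Let $\hat f(\xi)=\int_{\mathbb R} f(x)e^{-2\pi i x\xi}\,dx$, and let $\mathcal P(\mathbb R)$ be the set of Schwartz functions $f:\mathbb R\to\mathbb C$ such that $\hat f$ has compact support. Let $1\le p_1,p_2,p_3\le\infty$. For a locally integrable $m:\mathbb R^2\to\mathbb C$ and $f,g\in\mathcal P(\mathbb R)$ put $$B_m(f,g)(x)=\int_{\mathbb R^2}\hat f(\xi)\hat g(\eta)m(\xi,\eta)e^{2\pi i(\xi+\eta)x}\,d\xi\,d\eta .$$ We say that $m\in\mathcal{BM}_{(p_1,p_2,p_3)}$ if $m$ is locally integrable and there is $C>0$ with $\|B_m(f,g)\|_{p_3}\le C\|f\|_{p_1}\|g\|_{p_2}$ for all $f,g\in\mathcal P(\mathbb R)$, and $\|m\|_{p_1,p_2,p_3}$ denotes the infimum of such $C$. Write $s=\frac1{p_1}+\frac1{p_2}-\frac1{p_3}$ (with $1/\infty=0$). Let $m\in\mathcal{BM}_{(p_1,p_2,p_3)}$. Then: (a) If $1<p_1,p_2<\infty$, then for every rectangle $Q=[a,b]\times[c,d]$ we have $m\chi_Q\in\mathcal{BM}_{(p_1,p_2,p_3)}$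 and $\|m\chi_Q\|_{p_1,p_2,p_3}\le C\|m\|_{p_1,p_2,p_3}$, where the constant $C>0$ depends only on $p_1,p_2$. (b) Let $\Phi\in L^1(\mathbb R^2)$ and, if $s>0$, suppose also that $|\Phi|*|m|$ is locally integrable, so that the convolution $\Phi*m$ is well defined. Then the integral $(\Phi*m)(z)=\int_{\mathbb R^2}\Phi(u)m(z-u)\,du$ converges absolutely for almost every $z$, $\Phi*m\in\mathcal{BM}_{(p_1,p_2,p_3)}$ and $\|\Phi*m\|_{p_1,p_2,p_3}\le\|\Phi\|_{1}\|m\|_{p_1,p_2,p_3}$. (c) If $\Phi\in L^1(\mathbb R^2)$ and $\hat\Phi(\xi,\eta)=\int_{\mathbb R^2}\Phi(u,v)e^{-2\pi i(u\xi+v\eta)}\,du\,dv$, then $\hat\Phi m\in\mathcal{BM}_{(p_1,p_2,p_3)}$ and $\|\hat\Phi m\|_{p_1,p_2,p_3}\le\|\Phi\|_1\|m\|_{p_1,p_2,p_3}$. (d) Let $\psi:(0,\infty)\to\mathbb C$ be measurable with $\int_0^\infty|\psi(t)|\,t^{-s}\,dt<\infty$ and, if $s>0$, suppose also that $(\xi,\eta)\mapsto\int_0^\infty|m(t\xi,t\eta)|\,|\psi(t)|\,dt$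 is locally integrable, so that $m_\psi$ below is well defined. Then the integral $m_\psi(\xi,\eta)=\int_0^\infty m(t\xi,t\eta)\psi(t)\,dt$ converges absolutely for almost every $(\xi,\eta)$, $m_\psi\in\mathcal{BM}_{(p_1,p_2,p_3)}$ and $$\|m_\psi\|_{p_1,p_2,p_3}\le\Big(\int_0^\infty|\psi(t)|\,t^{\frac1{p_3}-(\frac1{p_1}+\frac1{p_2})}\,dt\Big)\|m\|_{p_1,p_2,p_3}.$$ -/

import Mathlib

open MeasureTheory Set
open scoped ENNReal FourierTransform SchwartzMap Convolution

noncomputable section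

namespace BilinearMultiplier

/-- The class `𝒫(ℝ)`: Schwartz functions whose Fourier transform
`f̂(ξ) = ∫ f(x) e^{-2πixξ} dx` has compact support. -/
def IsBandLimited (f : 𝓢(ℝ, ℂ)) : Prop :=
  HasCompactSupport (𝓕 (f : ℝ → ℂ))

/-- `B_m(f,g)(x) = ∫∫ f̂(ξ) ĝ(η) m(ξ,η) e^{2πi(ξ+η)x} dξ dη`. -/
def bilinearOp (m : ℝ × ℝ → ℂ) (f g : 𝓢(ℝ, ℂ)) (x : ℝ) : ℂ :=
  ∫ z : ℝ × ℝ, 𝓕 (f : ℝ → ℂ) z.1 * 𝓕 (g : ℝ → ℂ) z.2 * m z *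
    Complex.exp (2 * Real.pi * Complex.I * (((z.1 + z.2) * x : ℝ) : ℂ))

/-- `‖B_m(f,g)‖_{p₃} ≤ C ‖f‖_{p₁} ‖g‖_{p₂}` for all `f, g ∈ 𝒫(ℝ)`. -/
def BoundedBy (p₁ p₂ p₃ : ℝ≥0∞) (m : ℝ × ℝ → ℂ) (C : ℝ) : Prop :=
  ∀ f g : 𝓢(ℝ, ℂ), IsBandLimited f → IsBandLimited g →
    eLpNorm (bilinearOp m f g) p₃ volume ≤
      ENNReal.ofReal C * eLpNorm (f : ℝ → ℂ) p₁ volume * eLpNorm (g : ℝ → ℂ) p₂ volume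

/-- `m ∈ ℬℳ_{(p₁,p₂,p₃)}(ℝ)`. -/
def IsBilinearMultiplier (p₁ p₂ p₃ : ℝ≥0∞) (m : ℝ × ℝ → ℂ) : Prop :=
  LocallyIntegrable m volume ∧ ∃ C : ℝ, 0 < C ∧ BoundedBy p₁ p₂ p₃ m C

/-- `‖m‖_{p₁,p₂,p₃} = ‖B_m‖`, the infimum of the admissible constants. -/
def multiplierNorm (p₁ p₂ p₃ : ℝ≥0∞) (m : ℝ × ℝ → ℂ) : ℝ :=
  sInf {C : ℝ | 0 ≤ C ∧ BoundedBy p₁ p₂ p₃ m C}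

/-- The Fourier transform on `ℝ²`: `Φ̂(ξ,η) = ∫ Φ(u,v) e^{-2πi(uξ+vη)} du dv`. -/
def fourier₂ (Φ : ℝ × ℝ → ℂ) (z : ℝ × ℝ) : ℂ :=
  ∫ u : ℝ × ℝ, Φ u * Complex.exp (-(2 * Real.pi * Complex.I * ((u.1 * z.1 + u.2 * z.2 : ℝ) : ℂ)))

/-- The convolution `Φ * m` on `ℝ²`: `(Φ * m)(z) = ∫ Φ(u) m(z - u) du`. -/
def conv (Φ m : ℝ × ℝ → ℂ) : ℝ × ℝ → ℂ :=
  Φ ⋆[ContinuousLinearMap.mul ℂ ℂ, volume] m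

/-- `m_ψ(ξ,η) = ∫_0^∞ m(tξ,tη) ψ(t) dt`. -/
def dilationAverage (m : ℝ × ℝ → ℂ) (ψ : ℝ → ℂ) (z : ℝ × ℝ) : ℂ :=
  ∫ t in Ioi (0 : ℝ), m (t * z.1, t * z.2) * ψ t

/-- The number `1/p₃ - (1/p₁ + 1/p₂)`, with `1/∞ = 0`. -/
def homExponent (p₁ p₂ p₃ : ℝ≥0∞) : ℝ :=
  (p₃⁻¹).toReal - ((p₁⁻¹).toReal + (p₂⁻¹).toReal)

end BilinearMultiplier

end

open BilinearMultiplier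

open BilinearMultiplier

namespace BilinearMultiplier

open Filter Topology

/-! ### Averages in `L^p` -/

/-! The engine is an extension of the defining inequality. It is assumed for band-limited Schwartz
`f`, `g` only, yet it holds when `f̂`, `ĝ` are replaced by arbitrary bounded measurable `G`, `H` of
compact support (`BoundedBy.freqOp_le`). Indeed, mollifying `G` on the frequency side multiplies `𝓕⁻
G` by a function of modulus at most one, so no `L^p` norm grows, and Fatou's lemma passes to the
limit.

Translating, modulating or dilating the frequency data shows that `m(z - u)` and `e^{-2πi u·z} m(z)`
obey the same bound as `m`, while `m(t z)` costs a factor `t ^ homExponent`. The convolution, the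
product with `Φ̂` and the dilation average are integrals of such symbols against an integrable
weight, so `boundedBy_average` settles them: Fubini moves the average outside the operator and
Minkowski's inequality in `L^{p₃}` finishes. Fubini needs local integrability of the averaged
absolute values. If `homExponent` is nonnegative this is automatic, because blowing up at Lebesgue
points (`BoundedBy.ae_bound`) shows that `m` is essentially bounded, and zero almost everywhere when
the exponent is positive.

For rectangles, cutting `m` by `χ_Q` amounts to cutting `f̂` and `ĝ` to intervals, so what is needed
is the theorem of M. Riesz: frequency cut-offs to intervals are bounded on `L^p` for `1 < p < ∞`. An
interval is a difference of half-lines, and an exponentially damped half-line cut-off is a modulated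
Cauchy transform on a horizontal line. The latter is bounded uniformly in the height: for `p ≤ 2` by
integrating the holomorphic function `F^p` along rectangles, where `F` is the transform of a
nonnegative function, and for `p ≥ 2` by duality. -/

/-- For finite `p`, Jensen's inequality on the finite measure `ν` bounds the `p`-th power of the
average, and Tonelli lets the slices be integrated first. For `p = ∞` the two almost-everywhere
quantifiers are exchanged. -/
theorem eLpNorm_lintegral_le {X Ω : Type*} [MeasurableSpace X] [MeasurableSpace Ω]
    {μ : Measure X} {ν : Measure Ω} [SFinite μ] [IsFiniteMeasure ν] {p : ℝ≥0∞} (hp : 1 ≤ p)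
    {h : X × Ω → ℝ≥0∞} (hh : Measurable h) {M : ℝ≥0∞}
    (hM : ∀ᵐ ω ∂ν, eLpNorm (fun x => h (x, ω)) p μ ≤ M) :
    eLpNorm (fun x => ∫⁻ ω, h (x, ω) ∂ν) p μ ≤ ν univ * M := by
  rcases eq_or_ne p ∞ with rfl | hp'
  · simp only [eLpNorm_exponent_top] at hM ⊢
    have h1 : ∀ᵐ ω ∂ν, ∀ᵐ x ∂μ, h (x, ω) ≤ M := by
      filter_upwards [hM] with ω hω
      have := ae_le_eLpNormEssSup (f := fun x => h (x, ω)) (μ := μ)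
      filter_upwards [this] with x hx
      exact le_trans (by simpa using hx) hω
    have h4 : ∀ᵐ x ∂μ, ∀ᵐ ω ∂ν, h (x, ω) ≤ M :=
      (Measure.ae_ae_comm (p := fun x ω => h (x, ω) ≤ M) (hh measurableSet_Iic)).2 h1
    refine eLpNormEssSup_le_of_ae_enorm_bound ?_
    filter_upwards [h4] with x hx
    calc ‖∫⁻ ω, h (x, ω) ∂ν‖ₑ = ∫⁻ ω, h (x, ω) ∂ν := by simp
      _ ≤ ∫⁻ ω, M ∂ν := lintegral_mono_ae hx
      _ = ν univ * M := by rw [lintegral_const, mul_comm]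
  have hp0 : p ≠ 0 := (zero_lt_one.trans_le hp).ne'
  have hpr : 1 ≤ p.toReal := by
    simpa using ENNReal.toReal_mono hp' hp
  have hpos : 0 < p.toReal := by linarith
  rw [eLpNorm_eq_lintegral_rpow_enorm_toReal hp0 hp']
  -- Hölder against the constant `1`; `p = 1` is separate because it has no finite conjugate
  -- exponent.
  have key : ∀ᵐ x ∂μ, (∫⁻ ω, h (x, ω) ∂ν) ^ p.toReal ≤
      (ν univ) ^ (p.toReal - 1) * ∫⁻ ω, h (x, ω) ^ p.toReal ∂ν := by
    refine ae_of_all _ fun x => ?_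
    have hx : AEMeasurable (fun ω => h (x, ω)) ν := by fun_prop
    rcases eq_or_lt_of_le hpr with h1 | h1
    · simp [← h1]
    have hq : p.toReal.HolderConjugate (Real.conjExponent p.toReal) :=
      Real.HolderConjugate.conjExponent h1
    have h5 := ENNReal.lintegral_mul_le_Lp_mul_Lq ν hq hx (aemeasurable_const (b := 1))
    simp only [Pi.mul_apply, mul_one, ENNReal.one_rpow, lintegral_const, one_mul] at h5
    calc (∫⁻ ω, h (x, ω) ∂ν) ^ p.toReal
        ≤ ((∫⁻ ω, h (x, ω) ^ p.toReal ∂ν) ^ (1 / p.toReal) *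
          (ν univ) ^ (1 / Real.conjExponent p.toReal)) ^ p.toReal := by gcongr
      _ = _ := by
        rw [ENNReal.mul_rpow_of_nonneg _ _ hpos.le, ← ENNReal.rpow_mul, ← ENNReal.rpow_mul,
          one_div_mul_cancel hpos.ne', ENNReal.rpow_one, mul_comm]
        congr 2
        have := hq.symm.inv_add_inv_eq_one
        have h6 : (Real.conjExponent p.toReal)⁻¹ = 1 - p.toReal⁻¹ := by linarith
        rw [one_div, h6]
        field_simp
  have e1 : ∫⁻ x, ‖∫⁻ ω, h (x, ω) ∂ν‖ₑ ^ p.toReal ∂μ ≤ (ν univ * M) ^ p.toReal := by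
    calc ∫⁻ x, ‖∫⁻ ω, h (x, ω) ∂ν‖ₑ ^ p.toReal ∂μ
        ≤ ∫⁻ x, (ν univ) ^ (p.toReal - 1) * ∫⁻ ω, h (x, ω) ^ p.toReal ∂ν ∂μ := by
          apply lintegral_mono_ae
          simpa using key
      _ = (ν univ) ^ (p.toReal - 1) * ∫⁻ x, ∫⁻ ω, h (x, ω) ^ p.toReal ∂ν ∂μ := by
          rw [lintegral_const_mul' _ _ (ENNReal.rpow_ne_top_of_nonneg (by linarith)
            (measure_ne_top _ _))]
      _ = (ν univ) ^ (p.toReal - 1) * ∫⁻ ω, ∫⁻ x, h (x, ω) ^ p.toReal ∂μ ∂ν := by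
          rw [lintegral_lintegral_swap (f := fun x ω => h (x, ω) ^ p.toReal)]
          exact (hh.pow_const _).aemeasurable
      _ ≤ (ν univ) ^ (p.toReal - 1) * ∫⁻ ω, M ^ p.toReal ∂ν := by
          refine mul_le_mul_right (lintegral_mono_ae ?_) _
          filter_upwards [hM] with ω hω
          rw [eLpNorm_eq_lintegral_rpow_enorm_toReal hp0 hp', one_div,
            ENNReal.rpow_inv_le_iff hpos] at hω
          simpa using hω
      _ = (ν univ * M) ^ p.toReal := by
          rw [lintegral_const, ENNReal.mul_rpow_of_nonneg _ _ hpos.le]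
          rcases eq_or_ne (ν univ) 0 with h0 | h0
          · simp [h0, hpos]
          rw [mul_comm (M ^ p.toReal), ← mul_assoc]
          congr 1
          nth_rw 2 [← ENNReal.rpow_one (ν univ)]
          rw [← ENNReal.rpow_add _ _ h0 (measure_ne_top _ _)]
          simp
  rw [one_div, ENNReal.rpow_inv_le_iff hpos]
  exact e1

/-- The weight is absorbed into the finite measure `ν.withDensity w`, and `h` is replaced by a
measurable representative that agrees with it on almost every slice in both directions. -/
theorem eLpNorm_weighted_average_le {X Ω E : Type*} [MeasurableSpace X] [MeasurableSpace Ω]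
    [NormedAddCommGroup E]
    {μ : Measure X} {ν : Measure Ω} [SFinite μ] [SFinite ν] {p : ℝ≥0∞} (hp : 1 ≤ p)
    {w : Ω → ℝ≥0∞} (hw : AEMeasurable w ν) (hw' : ∫⁻ ω, w ω ∂ν ≠ ∞)
    {h : X × Ω → ℝ≥0∞} (hh : AEMeasurable h (μ.prod ν)) {M : ℝ≥0∞}
    (hM : ∀ᵐ ω ∂ν, eLpNorm (fun x => h (x, ω)) p μ ≤ M)
    {F : X → E} (hF : ∀ᵐ x ∂μ, ‖F x‖ₑ ≤ ∫⁻ ω, w ω * h (x, ω) ∂ν) :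
    eLpNorm F p μ ≤ (∫⁻ ω, w ω ∂ν) * M := by
  have : IsFiniteMeasure (ν.withDensity w) := isFiniteMeasure_withDensity hw'
  have hac : ν.withDensity w ≪ ν := withDensity_absolutelyContinuous _ _
  obtain ⟨h', hm, he⟩ := hh
  have he1 : ∀ᵐ x ∂μ, ∀ᵐ ω ∂ν, h (x, ω) = h' (x, ω) := Measure.ae_ae_of_ae_prod he
  have he2 : ∀ᵐ ω ∂ν, ∀ᵐ x ∂μ, h (x, ω) = h' (x, ω) := by
    have := (Measure.measurePreserving_swap (μ := ν) (ν := μ)).quasiMeasurePreserving.ae he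
    exact Measure.ae_ae_of_ae_prod this
  have hM' : ∀ᵐ ω ∂ν, eLpNorm (fun x => h' (x, ω)) p μ ≤ M := by
    filter_upwards [hM, he2] with ω h1 h2
    rwa [← eLpNorm_congr_ae h2]
  have := eLpNorm_lintegral_le (μ := μ) hp hm (hac.ae_le hM')
  rw [withDensity_apply _ MeasurableSet.univ, Measure.restrict_univ] at this
  refine le_trans (eLpNorm_mono_enorm_ae ?_) this
  filter_upwards [hF, he1] with x h1 h2
  rw [lintegral_withDensity_eq_lintegral_mul₀ hw (by fun_prop)]
  refine h1.trans (le_of_eq ?_)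
  rw [enorm_eq_self]
  refine lintegral_congr_ae ?_
  filter_upwards [h2] with ω h3
  simp [h3]

/-! ### The norm of a multiplier -/

theorem eLpNorm_schwartz_ne_top (f : 𝓢(ℝ, ℂ)) (p : ℝ≥0∞) : eLpNorm (f : ℝ → ℂ) p volume ≠ ∞ :=
  (f.memLp p volume).2.ne

theorem BoundedBy.mono {p₁ p₂ p₃ : ℝ≥0∞} {m : ℝ × ℝ → ℂ} {C D : ℝ}
    (h : BoundedBy p₁ p₂ p₃ m C) (hCD : C ≤ D) : BoundedBy p₁ p₂ p₃ m D := by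
  intro f g hf hg
  refine (h f g hf hg).trans ?_
  gcongr

theorem multiplierNorm_nonneg (p₁ p₂ p₃ : ℝ≥0∞) (m : ℝ × ℝ → ℂ) :
    0 ≤ multiplierNorm p₁ p₂ p₃ m :=
  Real.sInf_nonneg fun _ h => h.1

/-- The infimum is attained: the inequality is closed in `C`, since the norms of `f` and `g` are
finite. -/
theorem IsBilinearMultiplier.boundedBy {p₁ p₂ p₃ : ℝ≥0∞} {m : ℝ × ℝ → ℂ}
    (h : IsBilinearMultiplier p₁ p₂ p₃ m) :
    BoundedBy p₁ p₂ p₃ m (multiplierNorm p₁ p₂ p₃ m) := by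
  intro f g hf hg
  obtain ⟨-, C, hC, hb⟩ := h
  have hne : {C : ℝ | 0 ≤ C ∧ BoundedBy p₁ p₂ p₃ m C}.Nonempty := ⟨C, hC.le, hb⟩
  have hbd : BddBelow {C : ℝ | 0 ≤ C ∧ BoundedBy p₁ p₂ p₃ m C} := ⟨0, fun _ h => h.1⟩
  obtain ⟨u, -, hu, hu'⟩ := exists_seq_tendsto_sInf hne hbd
  have ht : Tendsto (fun n => ENNReal.ofReal (u n) * eLpNorm (f : ℝ → ℂ) p₁ volume *
      eLpNorm (g : ℝ → ℂ) p₂ volume) atTop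
      (𝓝 (ENNReal.ofReal (multiplierNorm p₁ p₂ p₃ m) * eLpNorm (f : ℝ → ℂ) p₁ volume *
      eLpNorm (g : ℝ → ℂ) p₂ volume)) := by
    refine ENNReal.Tendsto.mul_const (ENNReal.Tendsto.mul_const ?_ (.inr (eLpNorm_schwartz_ne_top _ _)))
      (.inr (eLpNorm_schwartz_ne_top _ _))
    exact ENNReal.tendsto_ofReal hu
  exact ge_of_tendsto' ht fun n => (hu' n).2 f g hf hg

theorem isBilinearMultiplier_and_norm_le {p₁ p₂ p₃ : ℝ≥0∞} {m : ℝ × ℝ → ℂ} {D : ℝ}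
    (hm : LocallyIntegrable m volume) (hD : 0 ≤ D) (h : BoundedBy p₁ p₂ p₃ m D) :
    IsBilinearMultiplier p₁ p₂ p₃ m ∧ multiplierNorm p₁ p₂ p₃ m ≤ D :=
  -- The class asks for a strictly positive constant, whereas `D` may be zero.
  ⟨⟨hm, D + 1, by linarith, h.mono (by linarith)⟩, csInf_le ⟨0, fun _ h => h.1⟩ ⟨hD, h⟩⟩

/-! ### Characters -/

/-- The character `e(t) = e^{2πit}`. -/
noncomputable def ee (t : ℝ) : ℂ := Complex.exp (2 * Real.pi * Complex.I * (t : ℂ))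

theorem ee_eq (t : ℝ) : ee t = Complex.exp (((2 * Real.pi * t : ℝ) : ℂ) * Complex.I) := by
  rw [ee]; congr 1; push_cast; ring

@[simp] theorem norm_ee (t : ℝ) : ‖ee t‖ = 1 := by
  rw [ee_eq, Complex.norm_exp_ofReal_mul_I]

@[simp] theorem enorm_ee (t : ℝ) : ‖ee t‖ₑ = 1 := by
  rw [← ofReal_norm, norm_ee, ENNReal.ofReal_one]

theorem ee_add (s t : ℝ) : ee (s + t) = ee s * ee t := by
  rw [ee, ee, ee, ← Complex.exp_add]; congr 1; push_cast; ring

@[simp] theorem ee_zero : ee 0 = 1 := by simp [ee]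

@[fun_prop] theorem continuous_ee : Continuous ee := by unfold ee; fun_prop

theorem fourierInv_apply (G : ℝ → ℂ) (x : ℝ) : 𝓕⁻ G x = ∫ ξ, G ξ * ee (ξ * x) := by
  rw [Real.fourierInv_eq']
  congr 1; ext ξ
  rw [ee_eq, smul_eq_mul, mul_comm]
  simp [mul_comm]

theorem fourier_apply (f : ℝ → ℂ) (ξ : ℝ) : 𝓕 f ξ = ∫ x, f x * ee (-(x * ξ)) := by
  rw [Real.fourier_eq']
  congr 1; ext x
  rw [ee_eq, smul_eq_mul, mul_comm]
  simp [mul_comm]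

/-! ### The bilinear form on bounded functions of compact support -/

/-- Bounded measurable functions of compact support. -/
structure IsBddComp (G : ℝ → ℂ) : Prop where
  measurable : Measurable G
  bounded : ∃ M : ℝ, ∀ x, ‖G x‖ ≤ M
  compact : HasCompactSupport G

/-- The bilinear operator with symbol `m`, in terms of the Fourier transforms of its arguments. -/
noncomputable def freqOp (m : ℝ × ℝ → ℂ) (G H : ℝ → ℂ) (x : ℝ) : ℂ :=
  ∫ z : ℝ × ℝ, G z.1 * H z.2 * m z * ee ((z.1 + z.2) * x)

theorem bilinearOp_eq (m : ℝ × ℝ → ℂ) (f g : 𝓢(ℝ, ℂ)) :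
    bilinearOp m f g = freqOp m (𝓕 (f : ℝ → ℂ)) (𝓕 (g : ℝ → ℂ)) := rfl

theorem IsBandLimited.isBddComp {f : 𝓢(ℝ, ℂ)} (hf : IsBandLimited f) :
    IsBddComp (𝓕 (f : ℝ → ℂ)) := by
  have hc : Continuous (𝓕 (f : ℝ → ℂ)) := by
    rw [← SchwartzMap.fourier_coe]; exact (𝓕 f).continuous
  exact ⟨hc.measurable, hf.exists_bound_of_continuous hc, hf⟩

theorem fourierInv_fourier_schwartz (f : 𝓢(ℝ, ℂ)) : 𝓕⁻ (𝓕 (f : ℝ → ℂ)) = f := by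
  rw [← SchwartzMap.fourier_coe, ← SchwartzMap.fourierInv_coe,
    FourierTransform.fourierInv_fourier_eq]

theorem IsBddComp.exists_bound {G : ℝ → ℂ} (hG : IsBddComp G) :
    ∃ M R : ℝ, 0 ≤ M ∧ 0 < R ∧ ∀ x, ‖G x‖ ≤ (Icc (-R) R).indicator (fun _ => M) x := by
  obtain ⟨M, hM⟩ := hG.bounded
  obtain ⟨R, hR⟩ := hG.compact.isCompact.isBounded.subset_closedBall 0
  refine ⟨M, max R 1, (norm_nonneg _).trans (hM 0), by positivity, fun x => ?_⟩
  by_cases hx : x ∈ Icc (-(max R 1)) (max R 1)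
  · simpa [hx] using hM x
  · have : x ∉ tsupport G := fun h => hx (by
      have := hR h
      rw [Real.closedBall_eq_Icc] at this
      exact ⟨by linarith [this.1, le_max_left R 1], by linarith [this.2, le_max_left R 1]⟩)
    simp [hx, image_eq_zero_of_notMem_tsupport this]

theorem isBddComp_of_bound {G : ℝ → ℂ} (hG : Measurable G) {M R : ℝ}
    (h : ∀ x, ‖G x‖ ≤ (Icc (-R) R).indicator (fun _ => M) x) : IsBddComp G := by
  refine ⟨hG, ⟨max M 0, fun x => (h x).trans ?_⟩, ?_⟩
  · by_cases hx : x ∈ Icc (-R) R <;> simp [hx]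
  · refine HasCompactSupport.of_support_subset_isCompact (isCompact_Icc (a := -R) (b := R)) ?_
    intro x hx
    by_contra h'
    have := h x
    simp only [h', not_false_eq_true, indicator_of_notMem, norm_le_zero_iff] at this
    exact hx this

theorem IsBddComp.integrable {G : ℝ → ℂ} (hG : IsBddComp G) : Integrable G := by
  obtain ⟨M, R, hM, hR, h⟩ := hG.exists_bound
  refine Integrable.mono' (g := (Icc (-R) R).indicator (fun _ => M)) ?_
    hG.measurable.aestronglyMeasurable (ae_of_all _ h)
  exact (integrable_indicator_iff measurableSet_Icc).2 (by simp)

theorem integrable_freq {m : ℝ × ℝ → ℂ} (hm : LocallyIntegrable m volume) {G H : ℝ → ℂ}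
    (hG : IsBddComp G) (hH : IsBddComp H) :
    Integrable (fun z : ℝ × ℝ => G z.1 * H z.2 * m z) := by
  obtain ⟨M, R, hM, hR, h⟩ := hG.exists_bound
  obtain ⟨N, S, hN, hS, h'⟩ := hH.exists_bound
  have hK : IntegrableOn m (Icc (-R) R ×ˢ Icc (-S) S) :=
    hm.integrableOn_isCompact (isCompact_Icc.prod isCompact_Icc)
  have hms : MeasurableSet (Icc (-R) R ×ˢ Icc (-S) S) := measurableSet_Icc.prod measurableSet_Icc
  refine Integrable.mono' (((integrable_indicator_iff hms).2 hK).norm.const_mul (M * N)) ?_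
    (ae_of_all _ fun z => ?_)
  · exact (((hG.measurable.comp measurable_fst).mul
      (hH.measurable.comp measurable_snd)).aestronglyMeasurable).mul hm.aestronglyMeasurable
  · rw [norm_mul, norm_mul]
    have h1 := h z.1
    have h2 := h' z.2
    by_cases hz1 : z.1 ∈ Icc (-R) R
    · by_cases hz2 : z.2 ∈ Icc (-S) S
      · rw [indicator_of_mem (show z ∈ Icc (-R) R ×ˢ Icc (-S) S from ⟨hz1, hz2⟩)]
        simp only [hz1, hz2, indicator_of_mem] at h1 h2
        gcongr
      · simp only [hz2, not_false_eq_true, indicator_of_notMem, norm_le_zero_iff] at h2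
        simp only [h2, norm_zero, mul_zero, zero_mul]
        positivity
    · simp only [hz1, not_false_eq_true, indicator_of_notMem, norm_le_zero_iff] at h1
      simp only [h1, norm_zero, zero_mul]
      positivity

theorem continuous_freqOp {m : ℝ × ℝ → ℂ} (hm : LocallyIntegrable m volume) {G H : ℝ → ℂ}
    (hG : IsBddComp G) (hH : IsBddComp H) : Continuous (freqOp m G H) := by
  have hi := integrable_freq hm hG hH
  refine continuous_of_dominated (bound := fun z : ℝ × ℝ => ‖G z.1 * H z.2 * m z‖) ?_ ?_ hi.norm ?_
  · intro x
    exact hi.aestronglyMeasurable.mul (by fun_prop)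
  · intro x
    exact ae_of_all _ fun z => by simp
  · exact ae_of_all _ fun z => by fun_prop

theorem continuous_fourierInv {G : ℝ → ℂ} (hG : Integrable G) : Continuous (𝓕⁻ G) := by
  have : 𝓕⁻ G = fun x => ∫ ξ, G ξ * ee (ξ * x) := funext (fourierInv_apply G)
  rw [this]
  refine continuous_of_dominated (bound := fun z => ‖G z‖) ?_ ?_ hG.norm ?_
  · intro x
    exact hG.aestronglyMeasurable.mul (by fun_prop)
  · intro x
    exact ae_of_all _ fun z => by simp
  · exact ae_of_all _ fun z => by fun_prop

/-! ### Changes of variable in `L^p` -/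

theorem eLpNorm_comp_add_right (f : ℝ → ℂ) (hf : Continuous f) (a : ℝ) (p : ℝ≥0∞) :
    eLpNorm (fun x => f (x + a)) p volume = eLpNorm f p volume :=
  eLpNorm_comp_measurePreserving hf.aestronglyMeasurable (measurePreserving_add_right volume a)

theorem eLpNorm_comp_mul_left (f : ℝ → ℂ) (hf : Continuous f) {t : ℝ} (ht : 0 < t)
    (p : ℝ≥0∞) :
    eLpNorm (fun x => f (t * x)) p volume =
      ENNReal.ofReal (t ^ (-(p⁻¹).toReal)) * eLpNorm f p volume := by
  have h1 : eLpNorm (fun x => f (t * x)) p volume =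
      eLpNorm f p (Measure.map (fun x => t * x) volume) := by
    rw [eLpNorm_map_measure hf.aestronglyMeasurable (by fun_prop)]; rfl
  rw [h1, Real.map_volume_mul_left ht.ne', eLpNorm_smul_measure_of_ne_zero, smul_eq_mul]
  · congr 1
    rw [abs_of_pos (by positivity), ENNReal.ofReal_rpow_of_pos (by positivity), one_div,
      Real.inv_rpow ht.le, Real.rpow_neg ht.le]
  · simpa using ht.ne'

/-! ### Extension to bounded frequency data of compact support -/

theorem tendsto_freqOp {m : ℝ × ℝ → ℂ} (hm : LocallyIntegrable m volume) {G H : ℝ → ℂ}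
    {Gn Hn : ℕ → ℝ → ℂ} (hGm : ∀ n, Measurable (Gn n)) (hHm : ∀ n, Measurable (Hn n))
    {M R N S : ℝ} (hGb : ∀ n x, ‖Gn n x‖ ≤ (Icc (-R) R).indicator (fun _ => M) x)
    (hHb : ∀ n x, ‖Hn n x‖ ≤ (Icc (-S) S).indicator (fun _ => N) x)
    (hG : ∀ᵐ x, Tendsto (fun n => Gn n x) atTop (𝓝 (G x)))
    (hH : ∀ᵐ x, Tendsto (fun n => Hn n x) atTop (𝓝 (H x))) (x : ℝ) :
    Tendsto (fun n => freqOp m (Gn n) (Hn n) x) atTop (𝓝 (freqOp m G H x)) := by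
  set G₀ : ℝ → ℂ := (Icc (-R) R).indicator (fun _ => (M : ℂ)) with hG₀
  set H₀ : ℝ → ℂ := (Icc (-S) S).indicator (fun _ => (N : ℂ)) with hH₀
  have hG₀b : IsBddComp G₀ := by
    refine isBddComp_of_bound (M := |M|) (R := R) (measurable_const.indicator measurableSet_Icc) ?_
    intro x
    by_cases hx : x ∈ Icc (-R) R <;> simp [hG₀, hx]
  have hH₀b : IsBddComp H₀ := by
    refine isBddComp_of_bound (M := |N|) (R := S) (measurable_const.indicator measurableSet_Icc) ?_
    intro x
    by_cases hx : x ∈ Icc (-S) S <;> simp [hH₀, hx]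
  have hGn : ∀ n x, ‖Gn n x‖ ≤ ‖G₀ x‖ := by
    intro n x
    refine (hGb n x).trans ?_
    by_cases hx : x ∈ Icc (-R) R <;> simp [hG₀, hx, le_abs_self]
  have hHn : ∀ n x, ‖Hn n x‖ ≤ ‖H₀ x‖ := by
    intro n x
    refine (hHb n x).trans ?_
    by_cases hx : x ∈ Icc (-S) S <;> simp [hH₀, hx, le_abs_self]
  refine tendsto_integral_of_dominated_convergence
    (fun z : ℝ × ℝ => ‖G₀ z.1 * H₀ z.2 * m z‖) ?_ (integrable_freq hm hG₀b hH₀b).norm ?_ ?_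
  · intro n
    exact (((((hGm n).comp measurable_fst).mul
      ((hHm n).comp measurable_snd)).aestronglyMeasurable).mul hm.aestronglyMeasurable).mul
      (by fun_prop)
  · intro n
    refine ae_of_all _ fun z => ?_
    simp only [norm_mul, norm_ee, mul_one]
    gcongr
    · exact hGn _ _
    · exact hHn _ _
  · have h1 : ∀ᵐ z : ℝ × ℝ, Tendsto (fun n => Gn n z.1) atTop (𝓝 (G z.1)) :=
      Measure.quasiMeasurePreserving_fst.ae hG
    have h2 : ∀ᵐ z : ℝ × ℝ, Tendsto (fun n => Hn n z.2) atTop (𝓝 (H z.2)) :=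
      Measure.quasiMeasurePreserving_snd.ae hH
    filter_upwards [h1, h2] with z h1 h2
    exact ((h1.mul h2).mul_const _).mul_const _

theorem norm_fourierInv_le (G : ℝ → ℂ) (x : ℝ) : ‖𝓕⁻ G x‖ ≤ ∫ ξ, ‖G ξ‖ := by
  rw [fourierInv_apply]
  refine (norm_integral_le_integral_norm _).trans (le_of_eq ?_)
  simp

theorem fourierInv_smul_convolution {ρ G : ℝ → ℂ} (hρ : Integrable ρ) (hG : Integrable G) (x : ℝ) :
    𝓕⁻ (ρ ⋆[ContinuousLinearMap.lsmul ℂ ℂ, volume] G) x = 𝓕⁻ ρ x * 𝓕⁻ G x := by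
  simp only [Real.fourierInv_eq_fourier_neg]
  rw [Real.fourier_smul_convolution_eq hρ hG, smul_eq_mul]

/-- With `f̂ₙ = ρₙ * G`, where `ρₙ ≥ 0` has integral one, `fₙ` is `𝓕⁻ ρₙ · 𝓕⁻ G` and `|𝓕⁻ ρₙ| ≤ 1`.
The resulting domination is pointwise and therefore serves every exponent, `∞` included. -/
theorem exists_mollification {G : ℝ → ℂ} (hG : IsBddComp G) :
    ∃ f : ℕ → 𝓢(ℝ, ℂ), (∀ n, IsBandLimited (f n)) ∧ (∀ n x, ‖f n x‖ ≤ ‖𝓕⁻ G x‖) ∧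
      (∃ M R : ℝ, ∀ n x, ‖𝓕 (f n : ℝ → ℂ) x‖ ≤ (Icc (-R) R).indicator (fun _ => M) x) ∧
      ∀ᵐ ξ, Tendsto (fun n => 𝓕 (f n : ℝ → ℂ) ξ) atTop (𝓝 (G ξ)) := by
  obtain ⟨M, R, hM, hR, hb⟩ := hG.exists_bound
  -- The ratio of the outer to the inner radius stays equal to `2`; almost-everywhere convergence of
  -- the convolutions to a merely locally integrable function needs such a bounded ratio.
  let φ : ℕ → ContDiffBump (0 : ℝ) := fun n =>
    ⟨1 / (2 * (n + 1)), 1 / (n + 1), by positivity, by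
      apply one_div_lt_one_div_of_lt <;> nlinarith [n.cast_nonneg (α := ℝ)]⟩
  let g : ℕ → ℝ → ℂ := fun n => (φ n).normed volume ⋆[ContinuousLinearMap.lsmul ℝ ℝ, volume] G
  have hgc : ∀ n, HasCompactSupport (g n) := fun n =>
    (φ n).hasCompactSupport_normed.convolution _ hG.compact
  have hgs : ∀ n, ContDiff ℝ ((⊤ : ℕ∞) : WithTop ℕ∞) (g n) := fun n =>
    (φ n).hasCompactSupport_normed.contDiff_convolution_left _ (φ n).contDiff_normed
      hG.integrable.locallyIntegrable
  have hgF : ∀ n, 𝓕 ((𝓕⁻ ((hgc n).toSchwartzMap (hgs n)) : 𝓢(ℝ, ℂ)) : ℝ → ℂ) = g n := by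
    intro n
    rw [← SchwartzMap.fourier_coe, FourierTransform.fourier_fourierInv_eq]
    rfl
  have hρi : ∀ n, Integrable ((φ n).normed (volume : Measure ℝ)) := fun n => (φ n).integrable_normed
  refine ⟨fun n => 𝓕⁻ ((hgc n).toSchwartzMap (hgs n)), fun n => ?_, fun n x => ?_, ?_, ?_⟩
  · rw [IsBandLimited, hgF]; exact hgc n
  · have h1 : g n = (fun x => (((φ n).normed volume x : ℝ) : ℂ))
        ⋆[ContinuousLinearMap.lsmul ℂ ℂ, volume] G := by
      ext x
      simp [g, convolution_def]
    rw [SchwartzMap.fourierInv_coe]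
    change ‖𝓕⁻ (g n) x‖ ≤ _
    have hρc : Integrable (fun x => (((φ n).normed volume x : ℝ) : ℂ)) := (hρi n).ofReal
    rw [h1, fourierInv_smul_convolution hρc hG.integrable, norm_mul]
    have h2 : ‖𝓕⁻ (fun x => (((φ n).normed volume x : ℝ) : ℂ)) x‖ ≤ 1 := by
      refine (norm_fourierInv_le _ _).trans (le_of_eq ?_)
      simp only [Complex.norm_real, Real.norm_eq_abs, abs_of_nonneg ((φ n).nonneg_normed _)]
      exact (φ n).integral_normed
    nlinarith [norm_nonneg (𝓕⁻ G x)]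
  · refine ⟨M, R + 1, fun n x => ?_⟩
    rw [hgF]
    have hle : ∀ y, ‖G y‖ ≤ M := fun y => (hb y).trans (by
      by_cases hy : y ∈ Icc (-R) R <;> simp [hy, hM])
    by_cases hx : x ∈ Icc (-(R + 1)) (R + 1)
    · rw [indicator_of_mem hx]
      simp only [g, convolution_def]
      calc ‖∫ t, (ContinuousLinearMap.lsmul ℝ ℝ) ((φ n).normed volume t) (G (x - t))‖
          ≤ ∫ t, (φ n).normed volume t * M := by
            refine norm_integral_le_of_norm_le ((hρi n).mul_const M) (ae_of_all _ fun t => ?_)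
            simp only [ContinuousLinearMap.lsmul_apply, norm_smul, Real.norm_eq_abs,
              abs_of_nonneg ((φ n).nonneg_normed _)]
            exact mul_le_mul_of_nonneg_left (hle _) ((φ n).nonneg_normed _)
        _ = M := by rw [integral_mul_const, (φ n).integral_normed, one_mul]
    · rw [indicator_of_notMem hx, norm_le_zero_iff]
      simp only [g, convolution_def]
      refine integral_eq_zero_of_ae (ae_of_all _ fun t => ?_)
      by_cases ht : t ∈ Function.support ((φ n).normed (volume : Measure ℝ))
      · rw [(φ n).support_normed_eq, Metric.mem_ball, dist_zero_right, Real.norm_eq_abs] at ht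
        have h3 : (φ n).rOut ≤ 1 := by
          change 1 / ((n : ℝ) + 1) ≤ 1
          rw [div_le_one (by positivity)]; linarith [n.cast_nonneg (α := ℝ)]
        have h4 : x - t ∉ Icc (-R) R := by
          intro h5
          have := abs_lt.1 (ht.trans_le h3)
          exact hx ⟨by linarith [h5.1, this.1], by linarith [h5.2, this.2]⟩
        have := hb (x - t)
        rw [indicator_of_notMem h4, norm_le_zero_iff] at this
        simp [this]
      · rw [Function.notMem_support] at ht
        simp [ht]
  · simp only [hgF]
    refine ContDiffBump.ae_convolution_tendsto_right_of_locallyIntegrable (K := 2) ?_ ?_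
      hG.integrable.locallyIntegrable
    · exact tendsto_one_div_add_atTop_nhds_zero_nat
    · refine Eventually.of_forall fun n => ?_
      change 1 / ((n : ℝ) + 1) ≤ 2 * (1 / (2 * (n + 1)))
      apply le_of_eq; field_simp

/-- Mollify both arguments: the right-hand sides are dominated by the norms of `𝓕⁻ G` and `𝓕⁻ H`,
the operators converge pointwise by dominated convergence, and Fatou's lemma concludes. -/
theorem BoundedBy.freqOp_le {p₁ p₂ p₃ : ℝ≥0∞} {m : ℝ × ℝ → ℂ} {C : ℝ}
    (h : BoundedBy p₁ p₂ p₃ m C) (hm : LocallyIntegrable m volume) {G H : ℝ → ℂ}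
    (hG : IsBddComp G) (hH : IsBddComp H) :
    eLpNorm (freqOp m G H) p₃ volume ≤
      ENNReal.ofReal C * eLpNorm (𝓕⁻ G) p₁ volume * eLpNorm (𝓕⁻ H) p₂ volume := by
  obtain ⟨f, hf, hfb, ⟨M, R, hfM⟩, hft⟩ := exists_mollification hG
  obtain ⟨g, hg, hgb, ⟨N, S, hgN⟩, hgt⟩ := exists_mollification hH
  refine Lp.eLpNorm_le_of_ae_tendsto (u := atTop) (f := fun n => bilinearOp m (f n) (g n))
    (Eventually.of_forall fun n => ?_) (fun n => ?_) (ae_of_all _ fun x => ?_)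
  · refine (h _ _ (hf n) (hg n)).trans ?_
    gcongr
    · exact eLpNorm_mono (hfb n)
    · exact eLpNorm_mono (hgb n)
  · rw [bilinearOp_eq]
    exact (continuous_freqOp hm (hf n).isBddComp (hg n).isBddComp).aestronglyMeasurable
  · simp only [bilinearOp_eq]
    exact tendsto_freqOp hm (fun n => (hf n).isBddComp.measurable)
      (fun n => (hg n).isBddComp.measurable) hfM hgN hft hgt x

/-! ### Symmetries of the class of multipliers -/

theorem locallyIntegrable_comp_sub {m : ℝ × ℝ → ℂ} (hm : LocallyIntegrable m volume) (u : ℝ × ℝ) :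
    LocallyIntegrable (fun z => m (z - u)) volume := by
  rw [locallyIntegrable_iff] at hm ⊢
  intro K hK
  have hK' : IsCompact ((fun z => z - u) '' K) := hK.image (by fun_prop)
  have := ((measurePreserving_sub_right (volume : Measure (ℝ × ℝ)) u).integrableOn_comp_preimage
    (Homeomorph.subRight u).measurableEmbedding).2 (hm _ hK')
  exact this.mono_set (subset_preimage_image _ _)

theorem locallyIntegrable_comp_smul {m : ℝ × ℝ → ℂ} (hm : LocallyIntegrable m volume) {t : ℝ}
    (ht : t ≠ 0) : LocallyIntegrable (fun z => m (t • z)) volume := by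
  rw [locallyIntegrable_iff] at hm ⊢
  intro K hK
  have hK' : IsCompact ((fun z => t • z) '' K) := hK.image (by fun_prop)
  have he : MeasurableEmbedding (fun z : ℝ × ℝ => t • z) :=
    (Homeomorph.smulOfNeZero t ht).measurableEmbedding
  have := he.integrableOn_map_iff (f := m) (μ := volume) (s := (fun z => t • z) '' K)
  rw [Measure.map_addHaar_smul _ ht] at this
  have h2 := this.1 (by
    rw [IntegrableOn, Measure.restrict_smul]
    exact (hm _ hK').integrable.smul_measure ENNReal.ofReal_ne_top)
  exact h2.mono_set (subset_preimage_image _ _)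

theorem IsBddComp.comp_add {G : ℝ → ℂ} (hG : IsBddComp G) (a : ℝ) :
    IsBddComp (fun ξ => G (ξ + a)) :=
  ⟨hG.measurable.comp (by fun_prop), hG.bounded.imp fun _ h x => h _,
    hG.compact.comp_homeomorph (Homeomorph.addRight a)⟩

theorem IsBddComp.mul_ee {G : ℝ → ℂ} (hG : IsBddComp G) (a : ℝ) :
    IsBddComp (fun ξ => G ξ * ee (-(a * ξ))) :=
  ⟨hG.measurable.mul (by fun_prop), hG.bounded.imp fun _ h x => by simpa using h x,
    hG.compact.mul_right⟩

/-- The factor `t⁻¹` makes the inverse transform exactly `𝓕⁻ G (t x)`; the two such factors account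
for the Jacobian `t⁻²` on the plane. -/
theorem IsBddComp.dilate {G : ℝ → ℂ} (hG : IsBddComp G) {t : ℝ} (ht : 0 < t) :
    IsBddComp (fun ξ => (t⁻¹ : ℝ) * G (t⁻¹ * ξ)) := by
  refine ⟨(hG.measurable.comp (by fun_prop)).const_mul _, ?_, ?_⟩
  · obtain ⟨M, hM⟩ := hG.bounded
    refine ⟨|t⁻¹| * M, fun x => ?_⟩
    rw [norm_mul, Complex.norm_real, Real.norm_eq_abs]
    gcongr
    exact hM _
  · exact (hG.compact.comp_homeomorph
      (Homeomorph.mulLeft₀ t⁻¹ (inv_ne_zero ht.ne'))).mul_left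

theorem fourierInv_comp_add (G : ℝ → ℂ) (a x : ℝ) :
    𝓕⁻ (fun ξ => G (ξ + a)) x = ee (-(a * x)) * 𝓕⁻ G x := by
  rw [fourierInv_apply, fourierInv_apply, ← integral_const_mul,
    ← integral_add_right_eq_self (fun ξ => ee (-(a * x)) * (G ξ * ee (ξ * x))) a]
  congr 1; ext ξ
  rw [mul_left_comm, ← ee_add]
  congr 2; ring

theorem fourierInv_mul_ee (G : ℝ → ℂ) (a x : ℝ) :
    𝓕⁻ (fun ξ => G ξ * ee (-(a * ξ))) x = 𝓕⁻ G (x - a) := by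
  rw [fourierInv_apply, fourierInv_apply]
  congr 1; ext ξ
  rw [mul_assoc, ← ee_add]
  congr 2; ring

theorem fourierInv_dilate (G : ℝ → ℂ) {t : ℝ} (ht : 0 < t) (x : ℝ) :
    𝓕⁻ (fun ξ => (t⁻¹ : ℝ) * G (t⁻¹ * ξ)) x = 𝓕⁻ G (t * x) := by
  rw [fourierInv_apply, fourierInv_apply]
  have := Measure.integral_comp_mul_left (fun ξ => (t⁻¹ : ℝ) * (G ξ * ee (ξ * (t * x)))) t⁻¹
  rw [inv_inv, abs_of_pos ht] at this
  calc _ = ∫ ξ, ((t⁻¹ : ℝ) : ℂ) * (G (t⁻¹ * ξ) * ee (t⁻¹ * ξ * (t * x))) := by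
        congr 1; ext ξ
        rw [mul_assoc]; congr 3; field_simp
    _ = _ := by
        rw [this, integral_const_mul, Complex.real_smul, ← mul_assoc, ← Complex.ofReal_mul,
          mul_inv_cancel₀ ht.ne', Complex.ofReal_one, one_mul]

/-- Translating the symbol translates `f̂` and `ĝ`, which only multiplies `f`, `g` and the output by
unimodular characters. -/
theorem BoundedBy.comp_sub {p₁ p₂ p₃ : ℝ≥0∞} {m : ℝ × ℝ → ℂ} {C : ℝ}
    (h : BoundedBy p₁ p₂ p₃ m C) (hm : LocallyIntegrable m volume) (u : ℝ × ℝ) :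
    BoundedBy p₁ p₂ p₃ (fun z => m (z - u)) C := by
  intro f g hf hg
  have hG := hf.isBddComp.comp_add u.1
  have hH := hg.isBddComp.comp_add u.2
  have key := h.freqOp_le hm hG hH
  have e1 : eLpNorm (𝓕⁻ (fun ξ => 𝓕 (f : ℝ → ℂ) (ξ + u.1))) p₁ volume
      = eLpNorm (f : ℝ → ℂ) p₁ volume := by
    refine eLpNorm_congr_norm_ae (ae_of_all _ fun x => ?_)
    rw [fourierInv_comp_add, norm_mul, norm_ee, one_mul, fourierInv_fourier_schwartz]
  have e2 : eLpNorm (𝓕⁻ (fun ξ => 𝓕 (g : ℝ → ℂ) (ξ + u.2))) p₂ volume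
      = eLpNorm (g : ℝ → ℂ) p₂ volume := by
    refine eLpNorm_congr_norm_ae (ae_of_all _ fun x => ?_)
    rw [fourierInv_comp_add, norm_mul, norm_ee, one_mul, fourierInv_fourier_schwartz]
  rw [e1, e2] at key
  refine le_trans (le_of_eq (eLpNorm_congr_norm_ae (ae_of_all _ fun x => ?_))) key
  rw [bilinearOp_eq, freqOp, ← integral_add_right_eq_self _ u]
  have : ∀ z : ℝ × ℝ, 𝓕 (f : ℝ → ℂ) (z + u).1 * 𝓕 (g : ℝ → ℂ) (z + u).2 * m (z + u - u) *
      ee (((z + u).1 + (z + u).2) * x) = ee ((u.1 + u.2) * x) *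
      (𝓕 (f : ℝ → ℂ) (z.1 + u.1) * 𝓕 (g : ℝ → ℂ) (z.2 + u.2) * m z * ee ((z.1 + z.2) * x)) := by
    intro z
    rw [add_sub_cancel_right, mul_left_comm (ee _), ← ee_add, Prod.fst_add, Prod.snd_add]
    congr 2; ring
  simp_rw [this]
  rw [integral_const_mul, norm_mul, norm_ee, one_mul]
  rfl

/-- The character splits between `f̂` and `ĝ`, where it acts as a translation of `f` and of `g`. -/
theorem BoundedBy.mul_ee {p₁ p₂ p₃ : ℝ≥0∞} {m : ℝ × ℝ → ℂ} {C : ℝ}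
    (h : BoundedBy p₁ p₂ p₃ m C) (hm : LocallyIntegrable m volume) (u : ℝ × ℝ) :
    BoundedBy p₁ p₂ p₃ (fun z => ee (-(u.1 * z.1 + u.2 * z.2)) * m z) C := by
  intro f g hf hg
  have key := h.freqOp_le hm (hf.isBddComp.mul_ee u.1) (hg.isBddComp.mul_ee u.2)
  have e : ∀ (f : 𝓢(ℝ, ℂ)) (a : ℝ) (p : ℝ≥0∞),
      eLpNorm (𝓕⁻ (fun ξ => 𝓕 (f : ℝ → ℂ) ξ * ee (-(a * ξ)))) p volume
      = eLpNorm (f : ℝ → ℂ) p volume := by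
    intro f a p
    rw [← eLpNorm_comp_add_right f f.continuous (-a)]
    congr 1; ext x
    rw [fourierInv_mul_ee, fourierInv_fourier_schwartz, sub_eq_add_neg]
  rw [e, e] at key
  convert key using 2
  ext x
  rw [bilinearOp_eq]
  unfold freqOp
  congr 1; ext z
  simp only [neg_add, ee_add]
  ring

/-- The inputs become `f(t·)` and `g(t·)`, costing `t^{-1/p₁}` and `t^{-1/p₂}`; the output is read
at `t⁻¹ x`, costing `t^{1/p₃}`. -/
theorem BoundedBy.comp_smul {p₁ p₂ p₃ : ℝ≥0∞} {m : ℝ × ℝ → ℂ} {C : ℝ}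
    (h : BoundedBy p₁ p₂ p₃ m C) (hm : LocallyIntegrable m volume) {t : ℝ} (ht : 0 < t) :
    BoundedBy p₁ p₂ p₃ (fun z => m (t • z)) (t ^ homExponent p₁ p₂ p₃ * C) := by
  intro f g hf hg
  have hG := hf.isBddComp.dilate ht
  have hH := hg.isBddComp.dilate ht
  have key := h.freqOp_le hm hG hH
  have e : ∀ (f : 𝓢(ℝ, ℂ)) (p : ℝ≥0∞),
      eLpNorm (𝓕⁻ (fun ξ => ((t⁻¹ : ℝ) : ℂ) * 𝓕 (f : ℝ → ℂ) (t⁻¹ * ξ))) p volume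
      = ENNReal.ofReal (t ^ (-(p⁻¹).toReal)) * eLpNorm (f : ℝ → ℂ) p volume := by
    intro f p
    rw [← eLpNorm_comp_mul_left f f.continuous ht]
    congr 1; ext x
    rw [fourierInv_dilate _ ht, fourierInv_fourier_schwartz]
  rw [e, e] at key
  have e3 : bilinearOp (fun z => m (t • z)) f g = fun x =>
      freqOp m (fun ξ => ((t⁻¹ : ℝ) : ℂ) * 𝓕 (f : ℝ → ℂ) (t⁻¹ * ξ))
        (fun ξ => ((t⁻¹ : ℝ) : ℂ) * 𝓕 (g : ℝ → ℂ) (t⁻¹ * ξ)) (t⁻¹ * x) := by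
    ext x
    rw [bilinearOp_eq, freqOp, freqOp]
    have := Measure.integral_comp_smul (volume : Measure (ℝ × ℝ)) (fun z : ℝ × ℝ =>
      ((t⁻¹ : ℝ) : ℂ) * 𝓕 (f : ℝ → ℂ) (t⁻¹ * z.1) * (((t⁻¹ : ℝ) : ℂ) * 𝓕 (g : ℝ → ℂ) (t⁻¹ * z.2)) *
        m z * ee ((z.1 + z.2) * (t⁻¹ * x))) t
    have hd : Module.finrank ℝ (ℝ × ℝ) = 2 := by simp
    rw [hd, abs_of_pos (by positivity)] at this
    rw [← inv_smul_eq_iff₀ (by positivity)] at this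
    rw [← this, inv_inv, ← integral_smul]
    congr 1; ext z
    have e4 : t⁻¹ * (t * z.1) = z.1 := by field_simp
    have e5 : t⁻¹ * (t * z.2) = z.2 := by field_simp
    have e6 : (t * z.1 + t * z.2) * (t⁻¹ * x) = (z.1 + z.2) * x := by field_simp
    have e7 : (t : ℂ) ≠ 0 := by exact_mod_cast ht.ne'
    simp only [Prod.smul_fst, Prod.smul_snd, smul_eq_mul, e4, e5, e6, Complex.real_smul]
    push_cast
    field_simp
  rw [e3, eLpNorm_comp_mul_left _ (continuous_freqOp hm hG hH) (inv_pos.2 ht)]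
  refine (mul_le_mul_right key _).trans (le_of_eq ?_)
  have e8 : t ^ homExponent p₁ p₂ p₃ = t⁻¹ ^ (-(p₃⁻¹).toReal) *
      t ^ (-(p₁⁻¹).toReal) * t ^ (-(p₂⁻¹).toReal) := by
    rw [Real.inv_rpow ht.le, ← Real.rpow_neg ht.le, ← Real.rpow_add ht, ← Real.rpow_add ht,
      homExponent]
    congr 1; ring
  rw [e8, ENNReal.ofReal_mul (by positivity), ENNReal.ofReal_mul (by positivity),
    ENNReal.ofReal_mul (by positivity)]
  ring

/-! ### Averages of multipliers -/

/-- The common source of the convolution, Fourier and dilation statements. `hfin` gives absolute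
integrability over compact sets of frequencies, which is all that Fubini requires because `f̂` and
`ĝ` have compact support; `hp₃` is what Minkowski's inequality requires. -/
theorem boundedBy_average {Ω : Type*} [MeasurableSpace Ω] {μ : Measure Ω} [SFinite μ]
    {p₁ p₂ p₃ : ℝ≥0∞} (hp₃ : 1 ≤ p₃) {w : Ω → ℂ} (hw : Integrable w μ) {k : (ℝ × ℝ) × Ω → ℂ}
    (hk : AEStronglyMeasurable k (volume.prod μ)) {C : ℝ}
    (hb : ∀ᵐ ω ∂μ, BoundedBy p₁ p₂ p₃ (fun z => k (z, ω)) C)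
    (hfin : ∀ K : Set (ℝ × ℝ), IsCompact K →
      ∫⁻ z in K, ∫⁻ ω, ‖w ω‖ₑ * ‖k (z, ω)‖ₑ ∂μ < ∞) :
    (∀ᵐ z : ℝ × ℝ, Integrable (fun ω => w ω * k (z, ω)) μ) ∧
      LocallyIntegrable (fun z : ℝ × ℝ => ∫ ω, w ω * k (z, ω) ∂μ) volume ∧
      BoundedBy p₁ p₂ p₃ (fun z => ∫ ω, w ω * k (z, ω) ∂μ) ((∫ ω, ‖w ω‖ ∂μ) * C) := by
  have hq : AEStronglyMeasurable (fun y : (ℝ × ℝ) × Ω => w y.2 * k y) (volume.prod μ) :=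
    (hw.aestronglyMeasurable.comp_snd).mul hk
  have hi : ∀ K : Set (ℝ × ℝ), IsCompact K →
      Integrable (fun y : (ℝ × ℝ) × Ω => w y.2 * k y) ((volume.restrict K).prod μ) := by
    intro K hK
    have hq' : AEStronglyMeasurable (fun y : (ℝ × ℝ) × Ω => w y.2 * k y)
        ((volume.restrict K).prod μ) :=
      hq.mono_ac (Measure.AbsolutelyContinuous.prod Measure.absolutelyContinuous_restrict
        Measure.AbsolutelyContinuous.rfl)
    refine ⟨hq', ?_⟩
    rw [hasFiniteIntegral_iff_enorm, lintegral_prod _ hq'.enorm]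
    simpa [enorm_mul] using hfin K hK
  refine ⟨?_, ?_, ?_⟩
  · have : ∀ n : ℕ, ∀ᵐ z : ℝ × ℝ, z ∈ Metric.closedBall (0 : ℝ × ℝ) n →
        Integrable (fun ω => w ω * k (z, ω)) μ := fun n =>
      (ae_restrict_iff' measurableSet_closedBall).1
        (hi _ (isCompact_closedBall (0 : ℝ × ℝ) n)).prod_right_ae
    filter_upwards [ae_all_iff.2 this] with z hz
    obtain ⟨n, hn⟩ := exists_nat_ge ‖z‖
    exact hz n (by simpa using hn)
  · rw [locallyIntegrable_iff]
    intro K hK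
    exact (hi K hK).integral_prod_left
  intro f g hf hg
  have hF := hf.isBddComp
  have hG := hg.isBddComp
  set F := 𝓕 (f : ℝ → ℂ) with hFd
  set G := 𝓕 (g : ℝ → ℂ) with hGd
  obtain ⟨M, R, hM, hR, hFb⟩ := hF.exists_bound
  obtain ⟨N, S, hN, hS, hGb⟩ := hG.exists_bound
  have hNm : Measurable (fun z : ℝ × ℝ => F z.1 * G z.2) :=
    (hF.measurable.comp measurable_fst).mul (hG.measurable.comp measurable_snd)
  have hfub : Integrable (fun y : (ℝ × ℝ) × Ω => F y.1.1 * G y.1.2 * (w y.2 * k y))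
      (volume.prod μ) := by
    have h1 := hi _ (isCompact_Icc.prod isCompact_Icc : IsCompact (Icc (-R) R ×ˢ Icc (-S) S))
    have hK : MeasurableSet ((Icc (-R) R ×ˢ Icc (-S) S) ×ˢ (univ : Set Ω)) :=
      (measurableSet_Icc.prod measurableSet_Icc).prod MeasurableSet.univ
    have h2 : IntegrableOn (fun y : (ℝ × ℝ) × Ω => w y.2 * k y)
        ((Icc (-R) R ×ˢ Icc (-S) S) ×ˢ univ) (volume.prod μ) := by
      rw [IntegrableOn, ← Measure.prod_restrict, Measure.restrict_univ]; exact h1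
    refine Integrable.mono' (((integrable_indicator_iff hK).2 h2).norm.const_mul (M * N))
      ((hNm.comp measurable_fst).aestronglyMeasurable.mul hq) (ae_of_all _ fun y => ?_)
    rw [norm_mul, norm_mul]
    have h1 := hFb y.1.1
    have h2 := hGb y.1.2
    by_cases hz1 : y.1.1 ∈ Icc (-R) R
    · by_cases hz2 : y.1.2 ∈ Icc (-S) S
      · rw [indicator_of_mem
          (show y ∈ (Icc (-R) R ×ˢ Icc (-S) S) ×ˢ (univ : Set Ω) from ⟨⟨hz1, hz2⟩, trivial⟩)]
        simp only [hz1, hz2, indicator_of_mem] at h1 h2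
        gcongr
      · simp only [hz2, not_false_eq_true, indicator_of_notMem, norm_le_zero_iff] at h2
        simp only [h2, norm_zero, mul_zero, zero_mul]
        positivity
    · simp only [hz1, not_false_eq_true, indicator_of_notMem, norm_le_zero_iff] at h1
      simp only [h1, norm_zero, zero_mul]
      positivity
  have hswap : ∀ x, bilinearOp (fun z => ∫ ω, w ω * k (z, ω) ∂μ) f g x =
      ∫ ω, w ω * bilinearOp (fun z => k (z, ω)) f g x ∂μ := by
    intro x
    simp only [bilinearOp_eq, freqOp]
    have h1 : Integrable (fun y : (ℝ × ℝ) × Ω => F y.1.1 * G y.1.2 * (w y.2 * k y) *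
        ee ((y.1.1 + y.1.2) * x)) (volume.prod μ) :=
      hfub.mul_bdd (c := 1) (by fun_prop) (ae_of_all _ fun y => by simp)
    calc _ = ∫ z : ℝ × ℝ, ∫ ω, F z.1 * G z.2 * (w ω * k (z, ω)) * ee ((z.1 + z.2) * x) ∂μ := by
          congr 1; ext z
          rw [integral_mul_const, integral_const_mul]
      _ = ∫ ω, (∫ z : ℝ × ℝ, F z.1 * G z.2 * (w ω * k (z, ω)) * ee ((z.1 + z.2) * x)) ∂μ :=
          integral_integral_swap (f := fun (z : ℝ × ℝ) ω =>
            F z.1 * G z.2 * (w ω * k (z, ω)) * ee ((z.1 + z.2) * x)) h1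
      _ = _ := by
          congr 1; ext ω
          rw [← integral_const_mul]
          congr 1; ext z
          ring
  -- Forgetting the spatial variable carries null sets back to null sets, so `k` stays
  -- almost-everywhere measurable on the triple product.
  have hqm : Measure.QuasiMeasurePreserving
      (fun y : (ℝ × Ω) × (ℝ × ℝ) => (y.2, y.1.2)) ((volume.prod μ).prod volume)
      (volume.prod μ) := by
    have h1 : Measure.QuasiMeasurePreserving (Prod.swap : (ℝ × Ω) × (ℝ × ℝ) → _)
        ((volume.prod μ).prod volume) (volume.prod (volume.prod μ)) :=
      Measure.measurePreserving_swap.quasiMeasurePreserving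
    have h2 : Measure.QuasiMeasurePreserving (Prod.map id Prod.snd : (ℝ × ℝ) × (ℝ × Ω) → _)
        (volume.prod (volume.prod μ)) (volume.prod μ) :=
      MeasureTheory.QuasiMeasurePreserving.prodMap (.id _) Measure.quasiMeasurePreserving_snd
    exact h2.comp h1
  have hB : AEStronglyMeasurable (fun y : ℝ × Ω => bilinearOp (fun z => k (z, y.2)) f g y.1)
      (volume.prod μ) := by
    simp only [bilinearOp_eq, freqOp]
    refine AEStronglyMeasurable.integral_prod_right' (f := fun y : (ℝ × Ω) × (ℝ × ℝ) =>
      F y.2.1 * G y.2.2 * k (y.2, y.1.2) * ee ((y.2.1 + y.2.2) * y.1.1)) ?_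
    exact (((hNm.comp measurable_snd).aestronglyMeasurable).mul
      (hk.comp_quasiMeasurePreserving hqm)).mul (by fun_prop)
  have hfinal := eLpNorm_weighted_average_le (μ := (volume : Measure ℝ)) (ν := μ) hp₃
    (w := fun ω => ‖w ω‖ₑ) hw.aestronglyMeasurable.enorm hw.2.ne
    (h := fun y => ‖bilinearOp (fun z => k (z, y.2)) f g y.1‖ₑ) hB.enorm
    (M := ENNReal.ofReal C * eLpNorm (f : ℝ → ℂ) p₁ volume * eLpNorm (g : ℝ → ℂ) p₂ volume)
    (F := bilinearOp (fun z => ∫ ω, w ω * k (z, ω) ∂μ) f g)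
    (by
      filter_upwards [hb] with ω hω
      rw [eLpNorm_enorm]
      exact hω f g hf hg)
    (ae_of_all _ fun x => by
      rw [hswap]
      refine (enorm_integral_le_lintegral_enorm _).trans (le_of_eq ?_)
      simp only [enorm_mul])
  refine hfinal.trans (le_of_eq ?_)
  rw [ENNReal.ofReal_mul (integral_nonneg fun _ => norm_nonneg _),
    ofReal_integral_norm_eq_lintegral_enorm hw]
  ring

/-! ### Multipliers of nonnegative homogeneity exponent are bounded -/

theorem exists_bandLimited_ne_zero : ∃ f : 𝓢(ℝ, ℂ), IsBandLimited f ∧ f 0 ≠ 0 := by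
  let φ : ContDiffBump (0 : ℝ) := ⟨1, 2, one_pos, one_lt_two⟩
  have hc : HasCompactSupport (fun x => ((φ x : ℝ) : ℂ)) :=
    φ.hasCompactSupport.comp_left (g := Complex.ofReal) Complex.ofReal_zero
  have hs : ContDiff ℝ ((⊤ : ℕ∞) : WithTop ℕ∞) (fun x => ((φ x : ℝ) : ℂ)) :=
    Complex.ofRealCLM.contDiff.comp φ.contDiff
  refine ⟨𝓕⁻ (hc.toSchwartzMap hs), ?_, ?_⟩
  · rw [IsBandLimited, ← SchwartzMap.fourier_coe, FourierTransform.fourier_fourierInv_eq]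
    exact hc
  · rw [SchwartzMap.fourierInv_coe]
    change 𝓕⁻ (fun x => ((φ x : ℝ) : ℂ)) 0 ≠ 0
    rw [fourierInv_apply]
    simp only [mul_zero, ee_zero, mul_one]
    rw [integral_complex_ofReal]
    exact_mod_cast (φ.integral_pos (μ := volume)).ne'

theorem freqOp_const (c : ℂ) (G H : ℝ → ℂ) (x : ℝ) :
    freqOp (fun _ => c) G H x = c * (𝓕⁻ G x * 𝓕⁻ H x) := by
  rw [fourierInv_apply, fourierInv_apply, freqOp, Measure.volume_eq_prod, ← integral_prod_mul,
    ← integral_const_mul]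
  congr 1; ext z
  rw [add_mul, ee_add]
  ring

/-- The norm on `ℝ × ℝ` is the maximum norm, so the closed ball is the square that supports the
product of `G` and `H`. -/
theorem norm_freqOp_le {m : ℝ × ℝ → ℂ} (hm : LocallyIntegrable m volume) {G H : ℝ → ℂ}
    {M R : ℝ} (hG : ∀ x, ‖G x‖ ≤ (Icc (-R) R).indicator (fun _ => M) x)
    (hH : ∀ x, ‖H x‖ ≤ (Icc (-R) R).indicator (fun _ => M) x) (x : ℝ) :
    ‖freqOp m G H x‖ ≤ M * M * ∫ z in Metric.closedBall (0 : ℝ × ℝ) R, ‖m z‖ := by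
  have hi : Integrable ((Metric.closedBall (0 : ℝ × ℝ) R).indicator (fun z => ‖m z‖)) :=
    (integrable_indicator_iff measurableSet_closedBall).2
      (hm.integrableOn_isCompact (isCompact_closedBall _ _)).norm
  rw [← integral_indicator measurableSet_closedBall, ← integral_const_mul]
  refine norm_integral_le_of_norm_le (hi.const_mul _) (ae_of_all _ fun z => ?_)
  rw [norm_mul, norm_ee, mul_one, norm_mul, norm_mul]
  have h1 := hG z.1
  have h2 := hH z.2
  by_cases hz : z ∈ Metric.closedBall (0 : ℝ × ℝ) R
  · have hz' : z.1 ∈ Icc (-R) R ∧ z.2 ∈ Icc (-R) R := by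
      rw [mem_closedBall_zero_iff, Prod.norm_def, max_le_iff, Real.norm_eq_abs, Real.norm_eq_abs,
        abs_le, abs_le] at hz
      exact hz
    simp only [hz'.1, hz'.2, indicator_of_mem] at h1 h2
    rw [indicator_of_mem hz]
    have := (norm_nonneg _).trans h1
    gcongr
  · rw [indicator_of_notMem hz, mul_zero]
    have : z.1 ∉ Icc (-R) R ∨ z.2 ∉ Icc (-R) R := by
      by_contra! h
      refine hz ?_
      rw [mem_closedBall_zero_iff, Prod.norm_def, max_le_iff, Real.norm_eq_abs, Real.norm_eq_abs,
        abs_le, abs_le]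
      exact h
    rcases this with h | h
    · rw [indicator_of_notMem h, norm_le_zero_iff] at h1
      simp [h1]
    · rw [indicator_of_notMem h, norm_le_zero_iff] at h2
      simp [h2]

/-- Turns an integral over a fixed ball into an average over a shrinking one, the form in which
Lebesgue differentiation applies. -/
theorem setIntegral_closedBall_rescale (h : ℝ × ℝ → ℝ) (z₀ : ℝ × ℝ) {ε R : ℝ} (hε : 0 < ε)
    (hR : 0 < R) :
    ∫ z in Metric.closedBall (0 : ℝ × ℝ) R, h (ε • z + z₀) =
      volume.real (Metric.closedBall (0 : ℝ × ℝ) R) *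
        ⨍ z in Metric.closedBall z₀ (ε * R), h z := by
  have h1 := Measure.setIntegral_comp_smul_of_pos (volume : Measure (ℝ × ℝ))
    (fun z => h (z + z₀)) (Metric.closedBall (0 : ℝ × ℝ) R) hε
  have h2 : ∫ z in Metric.closedBall (0 : ℝ × ℝ) (ε * R), h (z + z₀) =
      ∫ z in Metric.closedBall z₀ (ε * R), h z := by
    have := (measurePreserving_add_right (volume : Measure (ℝ × ℝ)) z₀).setIntegral_preimage_emb
      (Homeomorph.addRight z₀).measurableEmbedding h (Metric.closedBall z₀ (ε * R))
    rw [← this]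
    congr 2
    ext z
    simp [dist_eq_norm]
  rw [h1, smul_closedBall' hε.ne', smul_zero, Real.norm_eq_abs, abs_of_pos hε, h2, setAverage_eq,
    Measure.addHaar_real_closedBall _ _ hR.le, Measure.addHaar_real_closedBall _ _ (by positivity)]
  have h3 : volume.real (Metric.ball (0 : ℝ × ℝ) 1) ≠ 0 :=
    (ENNReal.toReal_pos (Metric.measure_ball_pos _ _ one_pos).ne'
      measure_ball_lt_top.ne).ne'
  have hd : Module.finrank ℝ (ℝ × ℝ) = 2 := by simp
  rw [hd]
  simp only [smul_eq_mul]
  field_simp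

theorem freqOp_sub {m m' : ℝ × ℝ → ℂ} (hm : LocallyIntegrable m volume)
    (hm' : LocallyIntegrable m' volume) {G H : ℝ → ℂ} (hG : IsBddComp G) (hH : IsBddComp H)
    (x : ℝ) : freqOp (fun z => m z - m' z) G H x = freqOp m G H x - freqOp m' G H x := by
  unfold freqOp
  rw [← integral_sub]
  · congr 1; ext z; ring
  · exact (integrable_freq hm hG hH).mul_bdd (c := 1) (by fun_prop) (ae_of_all _ fun y => by simp)
  · exact (integrable_freq hm' hG hH).mul_bdd (c := 1) (by fun_prop) (ae_of_all _ fun y => by simp)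

/-- At a Lebesgue point `z₀` the symbols `m(ε z + z₀)` tend to the constant `m z₀`, whose operator
is `m z₀` times the pointwise product `f g`. Their bounds are `ε ^ homExponent * C`, which stay at
most `C` for `ε ≤ 1`, and tend to zero when the exponent is positive. -/
theorem BoundedBy.ae_bound {p₁ p₂ p₃ : ℝ≥0∞} {m : ℝ × ℝ → ℂ} {C : ℝ}
    (h : BoundedBy p₁ p₂ p₃ m C) (hC : 0 ≤ C) (hm : LocallyIntegrable m volume) (hp₃ : 1 ≤ p₃)
    (hhom : 0 ≤ homExponent p₁ p₂ p₃) :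
    ∃ A : ℝ≥0∞, A ≠ ∞ ∧ ∀ᵐ z, ‖m z‖ₑ ≤ A ∧ (0 < homExponent p₁ p₂ p₃ → m z = 0) := by
  obtain ⟨f, hf, hf0⟩ := exists_bandLimited_ne_zero
  have hF := hf.isBddComp
  obtain ⟨M, R, hM, hR, hFb⟩ := hF.exists_bound
  set a := eLpNorm (f : ℝ → ℂ) p₁ volume with ha
  set b := eLpNorm (f : ℝ → ℂ) p₂ volume with hb
  set c := eLpNorm (fun x => f x * f x) p₃ volume with hc
  have hcc : Continuous fun x => f x * f x := f.continuous.mul f.continuous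
  have hc0 : c ≠ 0 := by
    intro h0
    rw [hc, eLpNorm_eq_zero_iff hcc.aestronglyMeasurable (zero_lt_one.trans_le hp₃).ne'] at h0
    have h1 := (hcc.ae_eq_iff_eq volume (continuous_const (y := (0 : ℂ)))).1 h0
    have := congrFun h1 0
    simp [hf0] at this
  let ε : ℕ → ℝ := fun n => 1 / ((n : ℝ) + 1)
  have hε : ∀ n, 0 < ε n := fun n => by positivity
  have hε0 : Tendsto ε atTop (𝓝 0) := tendsto_one_div_add_atTop_nhds_zero_nat
  -- One inequality for both conclusions: `D = C` yields boundedness, `D = ε k` with `k → ∞` yields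
  -- vanishing.
  have key : ∀ᵐ z₀, ∀ D : ℝ, (∀ᶠ n in atTop, ε n ^ homExponent p₁ p₂ p₃ * C ≤ D) →
      ‖m z₀‖ₑ * c ≤ ENNReal.ofReal D * a * b := by
    filter_upwards [IsUnifLocDoublingMeasure.ae_tendsto_average_norm_sub (μ := volume) hm 1]
      with z₀ hz₀ D hD
    have hav := hz₀ (l := atTop) (fun _ => z₀) (fun n => ε n * R)
      (tendsto_nhdsWithin_iff.2 ⟨by simpa using hε0.mul_const R,
        Eventually.of_forall fun n => mul_pos (hε n) hR⟩)
      (Eventually.of_forall fun n => by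
        simpa using (mul_pos (hε n) hR).le)
    have hli : ∀ n, LocallyIntegrable (fun z => m (ε n • z + z₀)) volume := by
      intro n
      have := locallyIntegrable_comp_smul (locallyIntegrable_comp_sub hm (-z₀)) (hε n).ne'
      simpa using this
    have hbd : ∀ n, BoundedBy p₁ p₂ p₃ (fun z => m (ε n • z + z₀))
        (ε n ^ homExponent p₁ p₂ p₃ * C) := by
      intro n
      have := (h.comp_sub hm (-z₀)).comp_smul (locallyIntegrable_comp_sub hm (-z₀)) (hε n)
      simpa using this
    have hlim : ∀ x, Tendsto (fun n => bilinearOp (fun z => m (ε n • z + z₀)) f f x) atTop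
        (𝓝 (m z₀ * (f x * f x))) := by
      intro x
      have e1 : m z₀ * (f x * f x) = freqOp (fun _ => m z₀) (𝓕 (f : ℝ → ℂ)) (𝓕 (f : ℝ → ℂ)) x := by
        rw [freqOp_const, fourierInv_fourier_schwartz]
      rw [e1, tendsto_iff_norm_sub_tendsto_zero]
      have h0 : Tendsto (fun n => M * M * (volume.real (Metric.closedBall (0 : ℝ × ℝ) R) *
        ⨍ z in Metric.closedBall z₀ (ε n * R), ‖m z - m z₀‖)) atTop (𝓝 0) := by
        simpa using (hav.const_mul _).const_mul (M * M)
      refine squeeze_zero (fun _ => norm_nonneg _) (fun n => ?_) h0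
      rw [bilinearOp_eq, ← freqOp_sub (hli n) (locallyIntegrable_const _) hF hF]
      refine (norm_freqOp_le ((hli n).sub (locallyIntegrable_const _)) hFb hFb x).trans ?_
      rw [← setIntegral_closedBall_rescale (fun z => ‖m z - m z₀‖) z₀ (hε n) hR]
      exact le_rfl
    have hle : eLpNorm (fun x => m z₀ * (f x * f x)) p₃ volume ≤ ENNReal.ofReal D * a * b := by
      refine Lp.eLpNorm_le_of_ae_tendsto (u := atTop)
        (f := fun n => bilinearOp (fun z => m (ε n • z + z₀)) f f) ?_ (fun n => ?_)
        (ae_of_all _ hlim)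
      · filter_upwards [hD] with n hn
        refine (hbd n f f hf hf).trans ?_
        gcongr
      · rw [bilinearOp_eq]
        exact (continuous_freqOp (hli n) hF hF).aestronglyMeasurable
    refine le_trans (le_of_eq ?_) hle
    exact (eLpNorm_const_smul (m z₀) (fun x => f x * f x) p₃ volume).symm
  have hat : a ≠ ∞ := eLpNorm_schwartz_ne_top _ _
  have hbt : b ≠ ∞ := eLpNorm_schwartz_ne_top _ _
  -- `f` is bounded by the `L¹` norm of its transform, so `f²` is dominated by a multiple of `f`.
  have hct : c ≠ ∞ := by
    have : ∀ x, ‖f x * f x‖ ≤ (∫ ξ, ‖𝓕 (f : ℝ → ℂ) ξ‖) * ‖f x‖ := by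
      intro x
      rw [norm_mul]
      gcongr
      nth_rw 1 [← fourierInv_fourier_schwartz f]
      exact norm_fourierInv_le _ _
    have h1 := eLpNorm_le_mul_eLpNorm_of_ae_le_mul (ae_of_all volume this) p₃
    exact ne_top_of_le_ne_top (ENNReal.mul_ne_top ENNReal.ofReal_ne_top (eLpNorm_schwartz_ne_top _ _)) h1
  refine ⟨ENNReal.ofReal C * a * b / c, ENNReal.div_ne_top (by finiteness) hc0, ?_⟩
  filter_upwards [key] with z hz
  constructor
  · rw [ENNReal.le_div_iff_mul_le (.inl hc0) (.inl hct)]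
    refine hz C (Eventually.of_forall fun n => mul_le_of_le_one_left hC ?_)
    refine Real.rpow_le_one (hε n).le ?_ hhom
    change 1 / ((n : ℝ) + 1) ≤ 1
    rw [div_le_one (by positivity)]; linarith [n.cast_nonneg (α := ℝ)]
  · intro hpos
    have h1 : Tendsto (fun n => ε n ^ homExponent p₁ p₂ p₃ * C) atTop (𝓝 0) := by
      have := (hε0.rpow_const (p := homExponent p₁ p₂ p₃) (.inr hpos.le)).mul_const C
      simpa [Real.zero_rpow hpos.ne'] using this
    have h2 : ∀ k : ℕ, ‖m z‖ₑ * c ≤ ENNReal.ofReal (ε k) * a * b := fun k =>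
      hz _ (h1.eventually (eventually_le_nhds (hε k)))
    have h3 : Tendsto (fun k => ENNReal.ofReal (ε k) * a * b) atTop (𝓝 0) := by
      have := ENNReal.Tendsto.mul_const (b := b)
        (ENNReal.Tendsto.mul_const (b := a) (ENNReal.tendsto_ofReal hε0) (.inr hat)) (.inr hbt)
      simpa using this
    have h4 : ‖m z‖ₑ * c ≤ 0 := ge_of_tendsto' h3 h2
    simpa [hc0] using h4

/-! ### Convolutions, products with Fourier transforms, and averages over dilations -/

/-- Each dilation by `t > 0` rescales Lebesgue measure, so measurability and almost-everywhere
properties of `m` pass to `m (t • z)` jointly in `t` and `z`. -/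
theorem quasiMeasurePreserving_smul_prod :
    Measure.QuasiMeasurePreserving (fun y : (ℝ × ℝ) × ℝ => y.2 • y.1)
      (volume.prod (volume.restrict (Ioi (0 : ℝ)))) volume := by
  refine QuasiMeasurePreserving.prod_of_left (by fun_prop) ?_
  filter_upwards [ae_restrict_mem measurableSet_Ioi] with t ht
  refine ⟨by fun_prop, ?_⟩
  rw [Measure.map_addHaar_smul _ (ne_of_gt ht)]
  exact Measure.smul_absolutelyContinuous

theorem multiplier_conv {p₁ p₂ p₃ : ℝ≥0∞} (hp₃ : 1 ≤ p₃) {m : ℝ × ℝ → ℂ}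
    (hm : IsBilinearMultiplier p₁ p₂ p₃ m) {Φ : ℝ × ℝ → ℂ} (hΦ : Integrable Φ volume)
    (hfin : homExponent p₁ p₂ p₃ < 0 → ∀ K : Set (ℝ × ℝ), IsCompact K →
      ∫⁻ z in K, ∫⁻ u : ℝ × ℝ, ‖Φ u‖ₑ * ‖m (z - u)‖ₑ < ∞) :
    (∀ᵐ z : ℝ × ℝ, Integrable (fun u : ℝ × ℝ => Φ u * m (z - u)) volume) ∧
      IsBilinearMultiplier p₁ p₂ p₃ (conv Φ m) ∧
      multiplierNorm p₁ p₂ p₃ (conv Φ m) ≤ (∫ u : ℝ × ℝ, ‖Φ u‖) * multiplierNorm p₁ p₂ p₃ m := by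
  have hb := hm.boundedBy
  have hn := multiplierNorm_nonneg p₁ p₂ p₃ m
  have hfin' : ∀ K : Set (ℝ × ℝ), IsCompact K →
      ∫⁻ z in K, ∫⁻ u : ℝ × ℝ, ‖Φ u‖ₑ * ‖m (z - u)‖ₑ < ∞ := by
    rcases lt_or_ge (homExponent p₁ p₂ p₃) 0 with hh | hh
    · exact hfin hh
    intro K hK
    obtain ⟨A, hA, hmA⟩ := hb.ae_bound hn hm.1 hp₃ hh
    calc ∫⁻ z in K, ∫⁻ u : ℝ × ℝ, ‖Φ u‖ₑ * ‖m (z - u)‖ₑ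
        ≤ ∫⁻ z in K, ∫⁻ u : ℝ × ℝ, ‖Φ u‖ₑ * A := by
          refine lintegral_mono fun z => lintegral_mono_ae ?_
          filter_upwards [(Measure.measurePreserving_sub_left volume z).quasiMeasurePreserving.ae hmA]
            with u hu
          gcongr
          exact hu.1
      _ < ∞ := by
          rw [lintegral_const, lintegral_mul_const' _ _ hA, Measure.restrict_apply_univ]
          exact ENNReal.mul_lt_top (ENNReal.mul_lt_top hΦ.2 hA.lt_top) hK.measure_lt_top
  have hk : AEStronglyMeasurable (fun y : (ℝ × ℝ) × (ℝ × ℝ) => m (y.1 - y.2))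
      (volume.prod volume) :=
    hm.1.aestronglyMeasurable.comp_quasiMeasurePreserving
      (quasiMeasurePreserving_sub volume volume)
  obtain ⟨h1, h2, h3⟩ := boundedBy_average hp₃ hΦ hk
    (ae_of_all _ fun u => hb.comp_sub hm.1 u) hfin'
  exact ⟨h1, isBilinearMultiplier_and_norm_le h2
    (mul_nonneg (integral_nonneg fun _ => norm_nonneg _) hn) h3⟩

theorem multiplier_fourier {p₁ p₂ p₃ : ℝ≥0∞} (hp₃ : 1 ≤ p₃) {m : ℝ × ℝ → ℂ}
    (hm : IsBilinearMultiplier p₁ p₂ p₃ m) {Φ : ℝ × ℝ → ℂ} (hΦ : Integrable Φ volume) :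
    IsBilinearMultiplier p₁ p₂ p₃ (fun z => fourier₂ Φ z * m z) ∧
      multiplierNorm p₁ p₂ p₃ (fun z => fourier₂ Φ z * m z) ≤
        (∫ u : ℝ × ℝ, ‖Φ u‖) * multiplierNorm p₁ p₂ p₃ m := by
  have hb := hm.boundedBy
  have hk : AEStronglyMeasurable (fun y : (ℝ × ℝ) × (ℝ × ℝ) =>
      ee (-(y.2.1 * y.1.1 + y.2.2 * y.1.2)) * m y.1) (volume.prod volume) :=
    AEStronglyMeasurable.mul (by fun_prop) hm.1.aestronglyMeasurable.comp_fst
  obtain ⟨-, h2, h3⟩ := boundedBy_average hp₃ hΦ hk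
    (ae_of_all _ fun u => hb.mul_ee hm.1 u) (fun K hK => by
      simp only [enorm_mul, enorm_ee, one_mul]
      calc ∫⁻ z in K, ∫⁻ u : ℝ × ℝ, ‖Φ u‖ₑ * ‖m z‖ₑ
          = ∫⁻ z in K, (∫⁻ u : ℝ × ℝ, ‖Φ u‖ₑ) * ‖m z‖ₑ := by
            refine lintegral_congr fun z => ?_
            rw [lintegral_mul_const' _ _ enorm_ne_top]
        _ < ∞ := by
            rw [lintegral_const_mul' _ _ hΦ.2.ne]
            exact ENNReal.mul_lt_top hΦ.2 (hm.1.integrableOn_isCompact hK).2)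
  have e : (fun z => fourier₂ Φ z * m z) =
      fun z => ∫ u, Φ u * (ee (-(u.1 * z.1 + u.2 * z.2)) * m z) := by
    ext z
    rw [fourier₂, ← integral_mul_const]
    congr 1; ext u
    rw [ee, ← mul_assoc]
    congr 3
    push_cast
    ring
  rw [e]
  exact isBilinearMultiplier_and_norm_le h2
    (mul_nonneg (integral_nonneg fun _ => norm_nonneg _) (multiplierNorm_nonneg _ _ _ _)) h3

theorem multiplier_dilationAverage {p₁ p₂ p₃ : ℝ≥0∞} (hp₃ : 1 ≤ p₃) {m : ℝ × ℝ → ℂ}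
    (hm : IsBilinearMultiplier p₁ p₂ p₃ m) {ψ : ℝ → ℂ}
    (hψ : IntegrableOn (fun t : ℝ => ψ t * ((t ^ homExponent p₁ p₂ p₃ : ℝ) : ℂ)) (Ioi 0) volume)
    (hfin : homExponent p₁ p₂ p₃ < 0 → ∀ K : Set (ℝ × ℝ), IsCompact K →
      ∫⁻ z in K, ∫⁻ t in Ioi (0 : ℝ), ‖m (t * z.1, t * z.2)‖ₑ * ‖ψ t‖ₑ < ∞) :
    (∀ᵐ z : ℝ × ℝ, IntegrableOn (fun t : ℝ => m (t * z.1, t * z.2) * ψ t) (Ioi 0) volume) ∧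
      IsBilinearMultiplier p₁ p₂ p₃ (dilationAverage m ψ) ∧
      multiplierNorm p₁ p₂ p₃ (dilationAverage m ψ) ≤
        (∫ t in Ioi (0 : ℝ), ‖ψ t‖ * t ^ homExponent p₁ p₂ p₃) * multiplierNorm p₁ p₂ p₃ m := by
  have hb := hm.boundedBy
  have hn := multiplierNorm_nonneg p₁ p₂ p₃ m
  -- This `s` is the opposite of `1/p₁ + 1/p₂ - 1/p₃`.
  set s := homExponent p₁ p₂ p₃ with hs
  have hfin' : ∀ K : Set (ℝ × ℝ), IsCompact K →
      ∫⁻ z in K, ∫⁻ t in Ioi (0 : ℝ), ‖m (t * z.1, t * z.2)‖ₑ * ‖ψ t‖ₑ < ∞ := by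
    rcases lt_or_ge s 0 with hh | hh
    · exact hfin hh
    intro K hK
    obtain ⟨A, hA, hmA⟩ := hb.ae_bound hn hm.1 hp₃ hh
    have h1 : ∀ᵐ z : ℝ × ℝ, ∀ᵐ t ∂volume.restrict (Ioi (0 : ℝ)),
        ‖m (t • z)‖ₑ ≤ A ∧ (0 < s → m (t • z) = 0) :=
      Measure.ae_ae_of_ae_prod (quasiMeasurePreserving_smul_prod.ae hmA)
    calc ∫⁻ z in K, ∫⁻ t in Ioi (0 : ℝ), ‖m (t * z.1, t * z.2)‖ₑ * ‖ψ t‖ₑ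
        ≤ ∫⁻ z in K, A * ∫⁻ t in Ioi (0 : ℝ), ‖ψ t * ((t ^ s : ℝ) : ℂ)‖ₑ := by
          refine lintegral_mono_ae ?_
          filter_upwards [ae_restrict_of_ae h1] with z hz
          rw [← lintegral_const_mul' _ _ hA]
          refine lintegral_mono_ae ?_
          filter_upwards [hz] with t ht
          -- For `s = 0` the weight `t ^ s` is `1` and boundedness of `m` suffices; for `s > 0` the
          -- left side is zero.
          rcases hh.eq_or_lt with h0 | h0
          · rw [← h0, Real.rpow_zero, Complex.ofReal_one, mul_one]
            gcongr
            exact ht.1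
          · have : m (t * z.1, t * z.2) = 0 := ht.2 h0
            simp [this]
      _ < ∞ := by
          rw [lintegral_const, Measure.restrict_apply_univ]
          exact ENNReal.mul_lt_top (ENNReal.mul_lt_top hA.lt_top hψ.2) hK.measure_lt_top
  have hcancel : ∀ t : ℝ, 0 < t → ∀ c : ℂ,
      ψ t * ((t ^ s : ℝ) : ℂ) * (((t ^ (-s) : ℝ) : ℂ) * c) = c * ψ t := by
    intro t ht c
    have h1 : ((t ^ s : ℝ) : ℂ) * ((t ^ (-s) : ℝ) : ℂ) = 1 := by
      rw [← Complex.ofReal_mul, ← Real.rpow_add ht]; simp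
    linear_combination (ψ t * c) * h1
  -- Dividing by `t ^ s` gives all dilates the same constant; the factor is returned to the weight
  -- `ψ t * t ^ s`.
  have hk : AEStronglyMeasurable (fun y : (ℝ × ℝ) × ℝ => ((y.2 ^ (-s) : ℝ) : ℂ) * m (y.2 • y.1))
      (volume.prod (volume.restrict (Ioi (0 : ℝ)))) := by
    refine AEStronglyMeasurable.mul (Measurable.aestronglyMeasurable (by fun_prop)) ?_
    exact hm.1.aestronglyMeasurable.comp_quasiMeasurePreserving quasiMeasurePreserving_smul_prod
  have hbk : ∀ᵐ t ∂volume.restrict (Ioi (0 : ℝ)),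
      BoundedBy p₁ p₂ p₃ (fun z : ℝ × ℝ => ((t ^ (-s) : ℝ) : ℂ) * m (t • z))
        (multiplierNorm p₁ p₂ p₃ m) := by
    filter_upwards [ae_restrict_mem measurableSet_Ioi] with t ht
    have ht0 : 0 < t := ht
    intro f g hf hg
    have h1 : bilinearOp (fun z : ℝ × ℝ => ((t ^ (-s) : ℝ) : ℂ) * m (t • z)) f g =
        ((t ^ (-s) : ℝ) : ℂ) • bilinearOp (fun z : ℝ × ℝ => m (t • z)) f g := by
      ext x
      simp only [Pi.smul_apply, smul_eq_mul, bilinearOp_eq, freqOp]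
      rw [← integral_const_mul]
      congr 1; ext z; ring
    rw [h1, eLpNorm_const_smul]
    refine (mul_le_mul_right (hb.comp_smul hm.1 ht0 f g hf hg) _).trans (le_of_eq ?_)
    rw [← ofReal_norm, Complex.norm_real, Real.norm_eq_abs, abs_of_nonneg (by positivity),
      ← mul_assoc, ← mul_assoc, ← ENNReal.ofReal_mul (by positivity), ← mul_assoc,
      ← Real.rpow_add ht0]
    simp [hs]
  obtain ⟨h1, h2, h3⟩ := boundedBy_average hp₃ hψ hk hbk (fun K hK => by
    refine lt_of_le_of_lt (lintegral_mono fun z => le_of_eq ?_) (hfin' K hK)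
    refine setLIntegral_congr_fun measurableSet_Ioi fun t ht => ?_
    rw [← enorm_mul, hcancel t ht, enorm_mul]
    rfl)
  have e : (fun z : ℝ × ℝ => ∫ t in Ioi (0 : ℝ), ψ t * ((t ^ s : ℝ) : ℂ) *
      (((t ^ (-s) : ℝ) : ℂ) * m (t • z))) = dilationAverage m ψ := by
    ext z
    exact setIntegral_congr_fun measurableSet_Ioi fun t ht => hcancel t ht _
  have e' : ∫ t in Ioi (0 : ℝ), ‖ψ t * ((t ^ s : ℝ) : ℂ)‖ =
      ∫ t in Ioi (0 : ℝ), ‖ψ t‖ * t ^ s := by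
    refine setIntegral_congr_fun measurableSet_Ioi fun t ht => ?_
    have ht0 : (0 : ℝ) < t := ht
    simp only [norm_mul, Complex.norm_real, Real.norm_eq_abs, abs_of_nonneg (Real.rpow_nonneg ht0.le s)]
  rw [e] at h2
  rw [e, e'] at h3
  refine ⟨?_, isBilinearMultiplier_and_norm_le h2 (mul_nonneg
    (setIntegral_nonneg measurableSet_Ioi fun t ht => mul_nonneg (norm_nonneg _)
      (Real.rpow_nonneg (le_of_lt ht) _)) hn) h3⟩
  filter_upwards [h1] with z hz
  exact IntegrableOn.congr_fun hz (fun t ht => hcancel t ht _) measurableSet_Ioi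

/-! ### The Cauchy transform on horizontal lines -/

/-- With `θ = |arg z| < π/2`: away from the imaginary axis `cos θ` is bounded below, so `(Re z)^p`
controls `|z|^p`; near it `pθ` exceeds `π/2`, so `-Re z^p` does. As `p ≤ 2`, `pθ` stays below `π`.
-/
theorem exists_norm_rpow_le_re {p : ℝ} (hp : 1 < p) (hp2 : p ≤ 2) :
    ∃ A B : ℝ, 0 ≤ A ∧ 0 ≤ B ∧ ∀ z : ℂ, 0 < z.re →
      ‖z‖ ^ p ≤ A * z.re ^ p - B * (z ^ (p : ℂ)).re := by
  have hpi := Real.pi_pos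
  -- The midpoint of `π/(2p)` and `π/2`.
  set θ₀ : ℝ := Real.pi / 4 * (1 + 1 / p) with hθ₀
  have hp0 : 0 < p := by linarith
  have h1p : 1 / p < 1 := by rw [div_lt_one hp0]; exact hp
  have h1p0 : 0 < 1 / p := by positivity
  have hθpos : 0 < θ₀ := by positivity
  have hθlt : θ₀ < Real.pi / 2 := by rw [hθ₀]; nlinarith
  have hpθ : Real.pi / 2 < p * θ₀ := by
    have : p * θ₀ = Real.pi / 4 * (p + 1) := by rw [hθ₀]; field_simp
    rw [this]; nlinarith
  have hpθ2 : p * θ₀ < Real.pi := by nlinarith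
  have hc : Real.cos (p * θ₀) < 0 := Real.cos_neg_of_pi_div_two_lt_of_lt hpθ (by linarith)
  have hc0 : 0 < Real.cos θ₀ := Real.cos_pos_of_mem_Ioo ⟨by linarith, hθlt⟩
  have hcp : 0 < Real.cos θ₀ ^ p := Real.rpow_pos_of_pos hc0 p
  set B : ℝ := 1 / (-Real.cos (p * θ₀)) with hB
  have hBpos : 0 < B := by rw [hB]; exact div_pos one_pos (by linarith)
  refine ⟨(1 + B) / Real.cos θ₀ ^ p, B, by positivity, hBpos.le, fun z hz => ?_⟩
  have hzn : 0 < ‖z‖ := norm_pos_iff.2 (by rintro rfl; simp at hz)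
  have harg : |z.arg| < Real.pi / 2 := Complex.abs_arg_lt_pi_div_two_iff.2 (.inl hz)
  have hre : z.re = ‖z‖ * Real.cos |z.arg| := by
    rw [Real.cos_abs, Complex.norm_mul_cos_arg]
  have hcpow : (z ^ (p : ℂ)).re = ‖z‖ ^ p * Real.cos (p * |z.arg|) := by
    rw [Complex.cpow_ofReal_re]
    congr 1
    rw [← Real.cos_abs, abs_mul, abs_of_pos hp0, mul_comm]
  set θ := |z.arg| with hθ
  have hθ0 : 0 ≤ θ := abs_nonneg _
  have hcosθ : 0 < Real.cos θ := Real.cos_pos_of_mem_Ioo ⟨by linarith, harg⟩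
  have key : 1 ≤ (1 + B) / Real.cos θ₀ ^ p * Real.cos θ ^ p - B * Real.cos (p * θ) := by
    rcases le_total θ θ₀ with h | h
    · have h1 : Real.cos θ₀ ≤ Real.cos θ :=
        Real.cos_le_cos_of_nonneg_of_le_pi hθ0 (by linarith) h
      have h2 : Real.cos θ₀ ^ p ≤ Real.cos θ ^ p := Real.rpow_le_rpow hc0.le h1 hp0.le
      have h3 : 1 + B ≤ (1 + B) / Real.cos θ₀ ^ p * Real.cos θ ^ p := by
        rw [div_mul_eq_mul_div, le_div_iff₀ hcp]
        gcongr
      nlinarith [Real.cos_le_one (p * θ)]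
    · have h1 : Real.cos (p * θ) ≤ Real.cos (p * θ₀) :=
        Real.cos_le_cos_of_nonneg_of_le_pi (by positivity) (by nlinarith) (by gcongr)
      have h2 : 1 ≤ -(B * Real.cos (p * θ)) := by
        have : B * (-Real.cos (p * θ₀)) = 1 := by
          rw [hB, one_div, inv_mul_cancel₀]; linarith
        nlinarith
      have h3 : 0 ≤ (1 + B) / Real.cos θ₀ ^ p * Real.cos θ ^ p := by positivity
      linarith
  rw [hre, hcpow, Real.mul_rpow hzn.le hcosθ.le]
  have hnp : 0 < ‖z‖ ^ p := Real.rpow_pos_of_pos hzn p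
  calc ‖z‖ ^ p = ‖z‖ ^ p * 1 := (mul_one _).symm
    _ ≤ ‖z‖ ^ p * ((1 + B) / Real.cos θ₀ ^ p * Real.cos θ ^ p - B * Real.cos (p * θ)) := by gcongr
    _ = _ := by ring

/-- Cauchy's theorem on the rectangle `[-R, R] × [y, y + R]`: the other three sides have total
length `4R` and lie outside the disc of radius `R`. Positivity of the real part keeps `F` off the
branch cut. -/
theorem norm_integral_cpow_le {F : ℂ → ℂ} (hF : DifferentiableOn ℂ F {w | 0 < w.im})
    (hre : ∀ w : ℂ, 0 < w.im → 0 < (F w).re) {p : ℝ} (hp : 0 ≤ p) {R K y : ℝ} (hR : 0 < R)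
    (hy : 0 < y) (hK : ∀ w : ℂ, 0 < w.im → R ≤ ‖w‖ → ‖F w‖ ≤ K) :
    ‖∫ x in (-R)..R, F (x + y * Complex.I) ^ (p : ℂ)‖ ≤ 4 * R * K ^ p := by
  have hd : DifferentiableOn ℂ (fun w => F w ^ (p : ℂ)) {w | 0 < w.im} := fun w hw =>
    (hF w hw).cpow_const (.inl (hre w hw))
  have h := Complex.integral_boundary_rect_eq_zero_of_differentiableOn (fun w => F w ^ (p : ℂ))
    ⟨-R, y⟩ ⟨R, y + R⟩ (hd.mono (by
      intro w hw
      have h2 := hw.2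
      rw [mem_preimage, uIcc_of_le (by simp [hR.le])] at h2
      exact lt_of_lt_of_le hy h2.1))
  have hb : ∀ w : ℂ, 0 < w.im → R ≤ ‖w‖ → ‖F w ^ (p : ℂ)‖ ≤ K ^ p := by
    intro w hw hw'
    rw [Complex.norm_cpow_real]
    exact Real.rpow_le_rpow (norm_nonneg _) (hK w hw hw') hp
  simp only at h
  have e1 : ‖∫ x in (-R)..R, F (x + (y + R : ℝ) * Complex.I) ^ (p : ℂ)‖ ≤ K ^ p * (2 * R) := by
    have := intervalIntegral.norm_integral_le_of_norm_le_const (a := -R) (b := R) (C := K ^ p)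
      (f := fun x : ℝ => F (x + (y + R : ℝ) * Complex.I) ^ (p : ℂ)) (fun x _ => by
        have him : ((x : ℂ) + (y + R : ℝ) * Complex.I).im = y + R := by simp
        refine hb _ (by rw [him]; linarith) (le_trans ?_ (Complex.abs_im_le_norm _))
        rw [him, abs_of_pos (by linarith)]; linarith)
    refine this.trans (le_of_eq ?_)
    rw [abs_of_pos (by linarith)]; ring
  have e2 : ∀ r : ℝ, |r| = R →
      ‖∫ v in y..(y + R), F (r + v * Complex.I) ^ (p : ℂ)‖ ≤ K ^ p * R := by
    intro r hr
    have := intervalIntegral.norm_integral_le_of_norm_le_const (a := y) (b := y + R) (C := K ^ p)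
      (f := fun v : ℝ => F (r + v * Complex.I) ^ (p : ℂ)) (fun v hv => by
        rw [uIoc_of_le (by linarith)] at hv
        have him : ((r : ℂ) + v * Complex.I).im = v := by simp
        have hre' : ((r : ℂ) + v * Complex.I).re = r := by simp
        refine hb _ (by rw [him]; linarith [hv.1]) (le_trans ?_ (Complex.abs_re_le_norm _))
        rw [hre', hr])
    refine this.trans (le_of_eq ?_)
    rw [abs_of_pos (by linarith)]; ring
  have e3 := e2 R (abs_of_pos hR)
  have e4 := e2 (-R) (by rw [abs_neg, abs_of_pos hR])
  set I₁ := ∫ x in (-R)..R, F (x + (y + R : ℝ) * Complex.I) ^ (p : ℂ)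
  set I₂ := ∫ v in y..(y + R), F (R + v * Complex.I) ^ (p : ℂ)
  set I₃ := ∫ v in y..(y + R), F ((-R : ℝ) + v * Complex.I) ^ (p : ℂ)
  set I₀ := ∫ x in (-R)..R, F (x + y * Complex.I) ^ (p : ℂ)
  have e5 : I₀ = I₁ - Complex.I * I₂ + Complex.I * I₃ := by
    simp only [smul_eq_mul] at h
    linear_combination h
  rw [e5]
  calc ‖I₁ - Complex.I * I₂ + Complex.I * I₃‖
      ≤ ‖I₁‖ + ‖Complex.I * I₂‖ + ‖Complex.I * I₃‖ :=
        (norm_add_le _ _).trans (add_le_add_left (norm_sub_le _ _) _)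
    _ = ‖I₁‖ + ‖I₂‖ + ‖I₃‖ := by simp
    _ ≤ 4 * R * K ^ p := by linarith

/-- The Cauchy transform `∫ f(t) i/(w - t) dt`. -/
noncomputable def cauchyOp (f : ℝ → ℂ) (w : ℂ) : ℂ := ∫ t : ℝ, f t * (Complex.I / (w - t))

theorem im_le_norm_sub (w : ℂ) (t : ℝ) : w.im ≤ ‖w - t‖ := by
  have := Complex.abs_im_le_norm (w - t)
  rw [Complex.sub_im, Complex.ofReal_im, sub_zero] at this
  exact (le_abs_self _).trans this

theorem integrable_cauchy {f : ℝ → ℂ} (hf : Integrable f) {w : ℂ} (hw : 0 < w.im) :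
    Integrable fun t : ℝ => f t * (Complex.I / (w - t)) := by
  refine hf.mul_bdd (c := 1 / w.im) (Measurable.aestronglyMeasurable (by fun_prop))
    (ae_of_all _ fun t => ?_)
  rw [norm_div, Complex.norm_I]
  exact one_div_le_one_div_of_le hw (im_le_norm_sub w t)

theorem norm_cauchyOp_le {f : ℝ → ℂ} (hf : Integrable f) {w : ℂ} {δ : ℝ} (hδ : 0 < δ)
    (h : ∀ t : ℝ, f t ≠ 0 → δ ≤ ‖w - t‖) : ‖cauchyOp f w‖ ≤ (∫ t, ‖f t‖) / δ := by
  rw [cauchyOp, ← integral_div]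
  refine norm_integral_le_of_norm_le (hf.norm.div_const _) (ae_of_all _ fun t => ?_)
  rw [norm_mul, norm_div, Complex.norm_I, mul_one_div]
  by_cases h0 : f t = 0
  · simp [h0]
  · exact div_le_div_of_nonneg_left (norm_nonneg _) hδ (h t h0)

theorem differentiableOn_cauchyOp {f : ℝ → ℂ} (hf : Integrable f) :
    DifferentiableOn ℂ (cauchyOp f) {w | 0 < w.im} := by
  intro w₀ hw₀
  have hw₀' : 0 < w₀.im := hw₀
  have hball : ∀ w ∈ Metric.ball w₀ (w₀.im / 2), w₀.im / 2 ≤ w.im := by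
    intro w hw
    rw [Metric.mem_ball, dist_eq_norm] at hw
    have := (Complex.abs_im_le_norm (w - w₀)).trans hw.le
    rw [Complex.sub_im, abs_le] at this
    linarith [this.1]
  have := hasDerivAt_integral_of_dominated_loc_of_deriv_le (𝕜 := ℂ) (μ := (volume : Measure ℝ))
    (F := fun w t => f t * (Complex.I / (w - t)))
    (F' := fun w t => f t * (-Complex.I / (w - t) ^ 2)) (x₀ := w₀)
    (s := Metric.ball w₀ (w₀.im / 2)) (bound := fun t => ‖f t‖ * (1 / (w₀.im / 2) ^ 2))
    (Metric.ball_mem_nhds _ (by linarith)) ?_ (integrable_cauchy hf hw₀') ?_ ?_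
    (hf.norm.mul_const _) ?_
  · exact this.2.differentiableAt.differentiableWithinAt
  · exact Eventually.of_forall fun w =>
      hf.aestronglyMeasurable.mul (Measurable.aestronglyMeasurable (by fun_prop))
  · exact hf.aestronglyMeasurable.mul (Measurable.aestronglyMeasurable (by fun_prop))
  · refine ae_of_all _ fun t w hw => ?_
    rw [norm_mul, norm_div, norm_neg, Complex.norm_I, norm_pow]
    gcongr
    exact (hball w hw).trans (im_le_norm_sub w t)
  · refine ae_of_all _ fun t w hw => ?_
    have h0 : w - t ≠ 0 := by
      have := (hball w hw).trans (im_le_norm_sub w t)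
      exact norm_pos_iff.1 (by linarith)
    have h1 : HasDerivAt (fun w : ℂ => w - t) 1 w := (hasDerivAt_id w).sub_const _
    have h2 := ((hasDerivAt_const w Complex.I).div h1 h0).const_mul (f t)
    simpa using h2

theorem continuous_cauchyOp_line {f : ℝ → ℂ} (hf : Integrable f) {y : ℝ} (hy : 0 < y) :
    Continuous fun x : ℝ => cauchyOp f (x + y * Complex.I) := by
  refine (differentiableOn_cauchyOp hf).continuousOn.comp_continuous (by fun_prop) fun x => ?_
  simpa using hy

theorem re_cauchy_kernel (x y t : ℝ) :
    (Complex.I / ((x : ℂ) + y * Complex.I - t)).re = y / ((x - t) ^ 2 + y ^ 2) := by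
  have : (x : ℂ) + y * Complex.I - t = ⟨x - t, y⟩ := by
    apply Complex.ext <;> simp
  rw [this, Complex.div_re]
  simp [Complex.normSq_apply]
  ring

theorem re_cauchyOp_ofReal {g : ℝ → ℝ} (hg : Integrable g) (x : ℝ) {y : ℝ} (hy : 0 < y) :
    (cauchyOp (fun t => (g t : ℂ)) (x + y * Complex.I)).re =
      ∫ t, g t * (y / ((x - t) ^ 2 + y ^ 2)) := by
  have hi := integrable_cauchy (f := fun t => (g t : ℂ)) hg.ofReal
    (w := (x : ℂ) + y * Complex.I) (by simpa using hy)
  have := integral_re hi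
  rw [cauchyOp]
  refine Eq.trans this.symm ?_
  congr 1; ext t
  change ((g t : ℂ) * (Complex.I / ((x : ℂ) + y * Complex.I - t))).re = _
  rw [Complex.re_ofReal_mul, re_cauchy_kernel]

theorem lintegral_poisson {y : ℝ} (hy : 0 < y) :
    ∫⁻ s : ℝ, ENNReal.ofReal (y / (s ^ 2 + y ^ 2)) = ENNReal.ofReal Real.pi := by
  have e : ∀ s : ℝ, y / (s ^ 2 + y ^ 2) = y⁻¹ * (1 + (y⁻¹ * s) ^ 2)⁻¹ := by
    intro s; field_simp; ring
  have hi : Integrable fun s : ℝ => y / (s ^ 2 + y ^ 2) := by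
    simp_rw [e]
    exact ((integrable_inv_one_add_sq.comp_mul_left' (inv_ne_zero hy.ne'))).const_mul _
  rw [← ofReal_integral_eq_lintegral_ofReal hi (ae_of_all _ fun s => by positivity)]
  congr 1
  simp_rw [e]
  rw [integral_const_mul, Measure.integral_comp_mul_left (fun s => (1 + s ^ 2)⁻¹) y⁻¹,
    integral_univ_inv_one_add_sq, inv_inv, abs_of_pos hy, smul_eq_mul, ← mul_assoc,
    inv_mul_cancel₀ hy.ne', one_mul]

/-- For real `g` the real part is convolution with the Poisson kernel, here of total mass `π`. -/
theorem eLpNorm_re_cauchyOp_le {g : ℝ → ℝ} (hg : Integrable g) (hgm : Measurable g) {y : ℝ}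
    (hy : 0 < y) {p : ℝ≥0∞} (hp : 1 ≤ p) :
    eLpNorm (fun x : ℝ => (cauchyOp (fun t => (g t : ℂ)) (x + y * Complex.I)).re) p volume ≤
      ENNReal.ofReal Real.pi * eLpNorm g p volume := by
  have hw : AEMeasurable (fun s : ℝ => ENNReal.ofReal (y / (s ^ 2 + y ^ 2))) volume := by fun_prop
  have := eLpNorm_weighted_average_le (μ := (volume : Measure ℝ)) (ν := (volume : Measure ℝ)) hp
    (w := fun s : ℝ => ENNReal.ofReal (y / (s ^ 2 + y ^ 2))) hw
    (by rw [lintegral_poisson hy]; exact ENNReal.ofReal_ne_top)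
    (h := fun q => ‖g (q.1 - q.2)‖ₑ) (by fun_prop) (M := eLpNorm g p volume)
    (ae_of_all _ fun s => by
      rw [eLpNorm_enorm]
      exact (eLpNorm_comp_measurePreserving hgm.aestronglyMeasurable
        (measurePreserving_sub_right volume s)).le)
    (F := fun x : ℝ => (cauchyOp (fun t => (g t : ℂ)) (x + y * Complex.I)).re)
    (ae_of_all _ fun x => by
      rw [re_cauchyOp_ofReal hg x hy,
        ← integral_sub_left_eq_self (fun t => g t * (y / ((x - t) ^ 2 + y ^ 2))) volume x]
      refine (enorm_integral_le_lintegral_enorm _).trans (le_of_eq ?_)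
      congr 1; ext s
      rw [enorm_mul, mul_comm, sub_sub_cancel]
      congr 1
      exact Real.enorm_of_nonneg (by positivity))
  rwa [lintegral_poisson hy] at this

theorem re_cauchyOp_pos {g : ℝ → ℝ} (hg : Integrable g) (h0 : ∀ t, 0 ≤ g t)
    (hne : ¬ g =ᵐ[volume] 0) {w : ℂ} (hw : 0 < w.im) :
    0 < (cauchyOp (fun t => (g t : ℂ)) w).re := by
  have hk : ∀ t, 0 < w.im / ((w.re - t) ^ 2 + w.im ^ 2) := fun t => by positivity
  have hi := integrable_cauchy (f := fun t => (g t : ℂ)) hg.ofReal hw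
  have hi' : Integrable fun t => g t * (w.im / ((w.re - t) ^ 2 + w.im ^ 2)) := by
    refine hi.re.congr (ae_of_all _ fun t => ?_)
    change ((g t : ℂ) * (Complex.I / (w - t))).re = _
    rw [Complex.re_ofReal_mul, ← Complex.re_add_im w, re_cauchy_kernel]
    simp
  rw [← Complex.re_add_im w, re_cauchyOp_ofReal hg _ hw,
    integral_pos_iff_support_of_nonneg (fun t => mul_nonneg (h0 t) (hk t).le) hi']
  have hs : Function.support (fun t => g t * (w.im / ((w.re - t) ^ 2 + w.im ^ 2))) =
      Function.support g := by
    ext t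
    rw [Function.mem_support, Function.mem_support, mul_ne_zero_iff]
    exact ⟨fun h => h.1, fun h => ⟨h, (hk t).ne'⟩⟩
  rw [hs, pos_iff_ne_zero]
  intro h
  refine hne ?_
  rw [EventuallyEq, ae_iff]
  exact h

/-- The Cauchy transform of a nonnegative function, for exponents in `(1, 2]`. -/
theorem exists_cauchyOp_nonneg_le {p : ℝ} (hp : 1 < p) (hp2 : p ≤ 2) :
    ∃ C : ℝ, 0 ≤ C ∧ ∀ g : ℝ → ℝ, IsBddComp (fun t => (g t : ℂ)) → Measurable g →
      (∀ t, 0 ≤ g t) → ∀ y : ℝ, 0 < y →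
      eLpNorm (fun x : ℝ => cauchyOp (fun t => (g t : ℂ)) (x + y * Complex.I)) (ENNReal.ofReal p)
        volume ≤ ENNReal.ofReal C * eLpNorm g (ENNReal.ofReal p) volume := by
  obtain ⟨A, B, hA, hB, hAB⟩ := exists_norm_rpow_le_re hp hp2
  have hp0 : 0 < p := by linarith
  refine ⟨A ^ (1 / p) * Real.pi, by positivity, fun g hg hgm h0 y hy => ?_⟩
  have hgi : Integrable g := by
    have := hg.integrable.re
    simpa using this
  -- The zero function is set apart because `F ^ p` needs a strictly positive real part.
  by_cases hne : g =ᵐ[volume] 0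
  · have : ∀ w, cauchyOp (fun t => (g t : ℂ)) w = 0 := by
      intro w
      refine integral_eq_zero_of_ae ?_
      filter_upwards [hne] with t ht
      simp [ht]
    simp [this]
  set F := cauchyOp (fun t => (g t : ℂ)) with hF
  have hFd : DifferentiableOn ℂ F {w | 0 < w.im} := differentiableOn_cauchyOp hg.integrable
  have hre : ∀ w : ℂ, 0 < w.im → 0 < (F w).re := fun w hw => re_cauchyOp_pos hgi h0 hne hw
  have hc : Continuous fun x : ℝ => F (x + y * Complex.I) :=
    continuous_cauchyOp_line hg.integrable hy
  have him : ∀ x : ℝ, 0 < ((x : ℂ) + y * Complex.I).im := fun x => by simpa using hy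
  have hcp : Continuous fun x : ℝ => F (x + y * Complex.I) ^ (p : ℂ) :=
    hc.cpow continuous_const fun x => .inl (hre _ (him x))
  obtain ⟨M, L, hM, hL, hbd⟩ := hg.exists_bound
  set J := ∫ t, ‖(g t : ℂ)‖ with hJ
  have hJ0 : 0 ≤ J := integral_nonneg fun _ => norm_nonneg _
  set V := ∫⁻ x : ℝ, ENNReal.ofReal ((F (x + y * Complex.I)).re ^ p) with hV
  -- `g` lives in `[-L, L]`, so `|w| ≥ R ≥ 2L` forces `|w - t| ≥ R/2` on its support.
  have hK : ∀ R : ℝ, 2 * L ≤ R → ∀ w : ℂ, 0 < w.im → R ≤ ‖w‖ → ‖F w‖ ≤ J / (R / 2) := by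
    intro R hR w hw hRw
    refine norm_cauchyOp_le hg.integrable (by linarith) fun t ht => ?_
    have ht' : t ∈ Icc (-L) L := by
      by_contra h'
      have := hbd t
      rw [indicator_of_notMem h', norm_le_zero_iff] at this
      exact ht this
    have : ‖(t : ℂ)‖ ≤ L := by
      rw [Complex.norm_real, Real.norm_eq_abs, abs_le]; exact ht'
    linarith [norm_sub_norm_le w t]
  have hmain : ∀ R : ℝ, 2 * L ≤ R → ∫⁻ x in Ioc (-R) R, ENNReal.ofReal (‖F (x + y * Complex.I)‖ ^ p)
      ≤ ENNReal.ofReal A * V + ENNReal.ofReal (B * (4 * R * (J / (R / 2)) ^ p)) := by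
    intro R hR
    have hR0 : 0 < R := by linarith
    have hle : -R ≤ R := by linarith
    have hcont := norm_integral_cpow_le hFd hre hp0.le hR0 hy (hK R hR)
    have hu : Continuous fun x : ℝ => (F (x + y * Complex.I)).re ^ p :=
      (Complex.continuous_re.comp hc).rpow_const fun x => .inr hp0.le
    have hn : Continuous fun x : ℝ => ‖F (x + y * Complex.I)‖ ^ p :=
      hc.norm.rpow_const fun x => .inr hp0.le
    have hr : Continuous fun x : ℝ => (F (x + y * Complex.I) ^ (p : ℂ)).re :=
      Complex.continuous_re.comp hcp
    have h1 : ∫ x in (-R)..R, ‖F (x + y * Complex.I)‖ ^ p ≤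
        A * (∫ x in (-R)..R, (F (x + y * Complex.I)).re ^ p) -
          B * ∫ x in (-R)..R, (F (x + y * Complex.I) ^ (p : ℂ)).re := by
      rw [← intervalIntegral.integral_const_mul, ← intervalIntegral.integral_const_mul,
        ← intervalIntegral.integral_sub ((hu.const_mul A).intervalIntegrable _ _)
          ((hr.const_mul B).intervalIntegrable _ _)]
      exact intervalIntegral.integral_mono_on hle (hn.intervalIntegrable _ _)
        (((hu.const_mul A).sub (hr.const_mul B)).intervalIntegrable _ _)
        fun x _ => hAB _ (hre _ (him x))
    have h2 : ∫ x in (-R)..R, (F (x + y * Complex.I) ^ (p : ℂ)).re =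
        (∫ x in (-R)..R, F (x + y * Complex.I) ^ (p : ℂ)).re := by
      exact Complex.reCLM.intervalIntegral_comp_comm (hcp.intervalIntegrable _ _)
    have h3 : -(∫ x in (-R)..R, (F (x + y * Complex.I) ^ (p : ℂ)).re) ≤
        4 * R * (J / (R / 2)) ^ p := by
      rw [h2]
      exact (neg_le_abs _).trans ((Complex.abs_re_le_norm _).trans hcont)
    have h4 : ENNReal.ofReal (∫ x in (-R)..R, (F (x + y * Complex.I)).re ^ p) ≤ V := by
      rw [intervalIntegral.integral_of_le hle, ofReal_integral_eq_lintegral_ofReal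
        ((hu.integrableOn_Icc).mono_set Ioc_subset_Icc_self)
        (ae_of_all _ fun x => Real.rpow_nonneg (hre _ (him x)).le _)]
      exact setLIntegral_le_lintegral _ _
    calc ∫⁻ x in Ioc (-R) R, ENNReal.ofReal (‖F (x + y * Complex.I)‖ ^ p)
        = ENNReal.ofReal (∫ x in (-R)..R, ‖F (x + y * Complex.I)‖ ^ p) := by
          rw [intervalIntegral.integral_of_le hle, ofReal_integral_eq_lintegral_ofReal
            ((hn.integrableOn_Icc).mono_set Ioc_subset_Icc_self)
            (ae_of_all _ fun x => by positivity)]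
      _ ≤ ENNReal.ofReal (A * (∫ x in (-R)..R, (F (x + y * Complex.I)).re ^ p) +
          B * (4 * R * (J / (R / 2)) ^ p)) := by
          apply ENNReal.ofReal_le_ofReal
          nlinarith [mul_le_mul_of_nonneg_left h3 hB]
      _ ≤ _ := by
          refine ENNReal.ofReal_add_le.trans ?_
          rw [ENNReal.ofReal_mul hA]
          gcongr
  have hlim : ∫⁻ x : ℝ, ENNReal.ofReal (‖F (x + y * Complex.I)‖ ^ p) ≤ ENNReal.ofReal A * V := by
    have t1 := (aecover_Ioc (μ := (volume : Measure ℝ)) (l := atTop) tendsto_neg_atTop_atBot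
      tendsto_id).lintegral_tendsto_of_countably_generated
      (f := fun x : ℝ => ENNReal.ofReal (‖F (x + y * Complex.I)‖ ^ p))
      (ENNReal.continuous_ofReal.comp
        (hc.norm.rpow_const fun x => .inr hp0.le)).measurable.aemeasurable
    -- The contour error is of order `R^{1-p}`; this is where `p > 1` enters.
    have t2 : Tendsto (fun R : ℝ => B * (4 * R * (J / (R / 2)) ^ p)) atTop (𝓝 0) := by
      have t3 : Tendsto (fun R : ℝ => B * (4 * (2 * J) ^ p) * R ^ (-(p - 1))) atTop (𝓝 0) := by
        simpa using (tendsto_rpow_neg_atTop (by linarith : 0 < p - 1)).const_mul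
          (B * (4 * (2 * J) ^ p))
      refine t3.congr' ?_
      filter_upwards [eventually_gt_atTop 0] with R hR
      have : J / (R / 2) = (2 * J) / R := by field_simp
      rw [this, Real.div_rpow (by positivity) hR.le, Real.rpow_neg hR.le, Real.rpow_sub_one hR.ne']
      field_simp
    have t4 : Tendsto (fun R : ℝ => ENNReal.ofReal A * V +
        ENNReal.ofReal (B * (4 * R * (J / (R / 2)) ^ p))) atTop (𝓝 (ENNReal.ofReal A * V)) := by
      simpa using (tendsto_const_nhds (x := ENNReal.ofReal A * V)).add
        (ENNReal.tendsto_ofReal t2)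
    refine le_of_tendsto_of_tendsto t1 t4 ?_
    filter_upwards [eventually_ge_atTop (2 * L)] with R hR
    exact hmain R hR
  have hpt : (ENNReal.ofReal p).toReal = p := ENNReal.toReal_ofReal hp0.le
  have hp0' : ENNReal.ofReal p ≠ 0 := by simpa using hp0
  have hP := eLpNorm_re_cauchyOp_le hgi hgm hy (p := ENNReal.ofReal p) (by simpa using hp.le)
  calc eLpNorm (fun x : ℝ => F (x + y * Complex.I)) (ENNReal.ofReal p) volume
      = (∫⁻ x : ℝ, ENNReal.ofReal (‖F (x + y * Complex.I)‖ ^ p)) ^ (1 / p) := by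
        rw [eLpNorm_eq_lintegral_rpow_enorm_toReal hp0' ENNReal.ofReal_ne_top, hpt]
        congr 1
        refine lintegral_congr fun x => ?_
        rw [← ofReal_norm, ENNReal.ofReal_rpow_of_nonneg (norm_nonneg _) hp0.le]
    _ ≤ (ENNReal.ofReal A * V) ^ (1 / p) := by gcongr
    _ = ENNReal.ofReal (A ^ (1 / p)) *
        eLpNorm (fun x : ℝ => (F (x + y * Complex.I)).re) (ENNReal.ofReal p) volume := by
        rw [ENNReal.mul_rpow_of_nonneg _ _ (by positivity),
          ENNReal.ofReal_rpow_of_nonneg hA (by positivity),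
          eLpNorm_eq_lintegral_rpow_enorm_toReal hp0' ENNReal.ofReal_ne_top, hpt]
        congr 2
        refine lintegral_congr fun x => ?_
        rw [Real.enorm_of_nonneg (hre _ (him x)).le,
          ENNReal.ofReal_rpow_of_nonneg (hre _ (him x)).le hp0.le]
    _ ≤ _ := by
        rw [ENNReal.ofReal_mul (by positivity), mul_assoc]
        gcongr

/-! ### `L^p` bounds for the Cauchy transform, `1 < p < ∞` -/

theorem cauchyOp_const_mul (c : ℂ) (f : ℝ → ℂ) (w : ℂ) :
    cauchyOp (fun t => c * f t) w = c * cauchyOp f w := by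
  unfold cauchyOp
  rw [← integral_const_mul]
  congr 1; ext t; ring

theorem IsBddComp.of_norm_le {f g : ℝ → ℂ} (hf : IsBddComp f) (hg : Measurable g)
    (h : ∀ x, ‖g x‖ ≤ ‖f x‖) : IsBddComp g := by
  obtain ⟨M, R, -, -, hb⟩ := hf.exists_bound
  exact isBddComp_of_bound hg fun x => (h x).trans (hb x)

theorem exists_cauchyOp_le_of_le_two {p : ℝ} (hp : 1 < p) (hp2 : p ≤ 2) :
    ∃ C : ℝ, 0 ≤ C ∧ ∀ f : ℝ → ℂ, IsBddComp f → ∀ y : ℝ, 0 < y →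
      eLpNorm (fun x : ℝ => cauchyOp f (x + y * Complex.I)) (ENNReal.ofReal p) volume ≤
        ENNReal.ofReal C * eLpNorm f (ENNReal.ofReal p) volume := by
  obtain ⟨C, hC, hpos⟩ := exists_cauchyOp_nonneg_le hp hp2
  refine ⟨4 * C, by positivity, fun f hf y hy => ?_⟩
  have hre := Complex.measurable_re.comp hf.measurable
  have him := Complex.measurable_im.comp hf.measurable
  -- Positive and negative parts of the real and imaginary parts, each dominated by `|f|`; hence the
  -- factor `4`.
  let g : Fin 4 → ℝ → ℝ := ![fun t => max (f t).re 0, fun t => max (-(f t).re) 0,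
    fun t => max (f t).im 0, fun t => max (-(f t).im) 0]
  have hgm : ∀ i, Measurable (g i) := by
    intro i
    fin_cases i
    · exact hre.max measurable_const
    · exact hre.neg.max measurable_const
    · exact him.max measurable_const
    · exact him.neg.max measurable_const
  have hg0 : ∀ i t, 0 ≤ g i t := by
    intro i t
    fin_cases i <;> exact le_max_right _ _
  have hgle : ∀ i t, ‖(g i t : ℂ)‖ ≤ ‖f t‖ := by
    intro i t
    rw [Complex.norm_real, Real.norm_eq_abs, abs_of_nonneg (hg0 i t)]
    have h1 := abs_le.1 (Complex.abs_re_le_norm (f t))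
    have h2 := abs_le.1 (Complex.abs_im_le_norm (f t))
    fin_cases i
    · exact max_le h1.2 (norm_nonneg _)
    · exact max_le (by linarith [h1.1]) (norm_nonneg _)
    · exact max_le h2.2 (norm_nonneg _)
    · exact max_le (by linarith [h2.1]) (norm_nonneg _)
  have hgb : ∀ i, IsBddComp (fun t => (g i t : ℂ)) := fun i =>
    hf.of_norm_le (Complex.measurable_ofReal.comp (hgm i)) (hgle i)
  let c : Fin 4 → ℂ := ![1, -1, Complex.I, -Complex.I]
  have hc : ∀ i, ‖c i‖ = 1 := by
    intro i
    fin_cases i <;> simp [c]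
  have hdec : ∀ t, f t = ∑ i, c i * (g i t : ℂ) := by
    intro t
    simp only [Fin.sum_univ_four, c, g]
    have h1 : max (f t).re 0 - max (-(f t).re) 0 = (f t).re := by
      rcases le_total 0 (f t).re with h | h <;> simp [h]
    have h2 : max (f t).im 0 - max (-(f t).im) 0 = (f t).im := by
      rcases le_total 0 (f t).im with h | h <;> simp [h]
    apply Complex.ext
    · simp; linarith
    · simp; linarith
  have hsum : (fun x : ℝ => cauchyOp f (x + y * Complex.I)) =
      ∑ i, c i • fun x : ℝ => cauchyOp (fun t => (g i t : ℂ)) (x + y * Complex.I) := by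
    ext x
    have hx : 0 < ((x : ℂ) + y * Complex.I).im := by simpa using hy
    simp only [Finset.sum_apply, Pi.smul_apply, smul_eq_mul, ← cauchyOp_const_mul]
    unfold cauchyOp
    rw [← integral_finsetSum]
    · congr 1; ext t
      rw [hdec t, Finset.sum_mul]
    · intro i _
      exact integrable_cauchy ((hgb i).integrable.const_mul _) hx
  rw [hsum]
  have hmeas : ∀ i, AEStronglyMeasurable
      (fun x : ℝ => cauchyOp (fun t => (g i t : ℂ)) (x + y * Complex.I)) volume := fun i =>
    (continuous_cauchyOp_line (hgb i).integrable hy).aestronglyMeasurable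
  refine (eLpNorm_sum_le (fun i _ => (hmeas i).const_smul (c i))
    (by simpa using hp.le)).trans ?_
  calc ∑ i, eLpNorm (c i • fun x : ℝ => cauchyOp (fun t => (g i t : ℂ)) (x + y * Complex.I))
        (ENNReal.ofReal p) volume
      ≤ ∑ i : Fin 4, ENNReal.ofReal C * eLpNorm f (ENNReal.ofReal p) volume := by
        refine Finset.sum_le_sum fun i _ => ?_
        rw [eLpNorm_const_smul, ← ofReal_norm, hc, ENNReal.ofReal_one, one_mul]
        refine (hpos (g i) (hgb i) (hgm i) (hg0 i) y hy).trans ?_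
        gcongr
        exact eLpNorm_mono fun t => by simpa using hgle i t
    _ = _ := by
        rw [Finset.sum_const, Finset.card_univ, Fintype.card_fin, nsmul_eq_mul,
          ENNReal.ofReal_mul (by norm_num), ← mul_assoc]
        norm_num

/-- The transpose of the transform at height `y` is the same transform conjugated by the reflection
`t ↦ -t`, so bounds for the conjugate exponent transfer. -/
theorem integral_mul_cauchyOp {f g : ℝ → ℂ} (hf : IsBddComp f) (hg : IsBddComp g) {y : ℝ}
    (hy : 0 < y) :
    ∫ x : ℝ, g x * cauchyOp f (x + y * Complex.I) =
      ∫ t : ℝ, f t * cauchyOp (fun v => g (-v)) ((-t : ℝ) + y * Complex.I) := by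
  have hi : Integrable (fun q : ℝ × ℝ =>
      g q.1 * f q.2 * (Complex.I / ((q.1 : ℂ) + y * Complex.I - q.2))) (volume.prod volume) := by
    refine (hg.integrable.mul_prod hf.integrable).mul_bdd (c := 1 / y)
      (Measurable.aestronglyMeasurable (by fun_prop)) (ae_of_all _ fun q => ?_)
    rw [norm_div, Complex.norm_I]
    have := im_le_norm_sub ((q.1 : ℂ) + y * Complex.I) q.2
    exact one_div_le_one_div_of_le hy (by simpa using this)
  calc ∫ x : ℝ, g x * cauchyOp f (x + y * Complex.I)
      = ∫ x : ℝ, ∫ t : ℝ, g x * f t * (Complex.I / ((x : ℂ) + y * Complex.I - t)) := by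
        congr 1; ext x
        rw [cauchyOp, ← integral_const_mul]
        congr 1; ext t; ring
    _ = ∫ t : ℝ, ∫ x : ℝ, g x * f t * (Complex.I / ((x : ℂ) + y * Complex.I - t)) :=
        integral_integral_swap hi
    _ = _ := by
        congr 1; ext t
        rw [cauchyOp, ← integral_const_mul,
          ← integral_neg_eq_self (fun v : ℝ => f t * (g (-v) *
            (Complex.I / (((-t : ℝ) : ℂ) + y * Complex.I - v))))]
        congr 1; ext x
        have : ((-t : ℝ) : ℂ) + y * Complex.I - ((-x : ℝ) : ℂ) = (x : ℂ) + y * Complex.I - t := by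
          push_cast; ring
        rw [this, neg_neg]
        ring

theorem exists_cauchyOp_le_of_two_le {p : ℝ} (hp : 2 ≤ p) :
    ∃ C : ℝ, 0 ≤ C ∧ ∀ f : ℝ → ℂ, IsBddComp f → ∀ y : ℝ, 0 < y →
      eLpNorm (fun x : ℝ => cauchyOp f (x + y * Complex.I)) (ENNReal.ofReal p) volume ≤
        ENNReal.ofReal C * eLpNorm f (ENNReal.ofReal p) volume := by
  have hp0 : 0 < p := by linarith
  set q := Real.conjExponent p with hq
  have hpq : p.HolderConjugate q := Real.HolderConjugate.conjExponent (by linarith)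
  have hq1 : 1 < q := hpq.symm.lt
  have hq0 : 0 < q := by linarith
  have hq2 : q ≤ 2 := by
    have h1 := hpq.inv_add_inv_eq_one
    have h2 : p⁻¹ ≤ 2⁻¹ := inv_anti₀ two_pos hp
    have h3 : (2 : ℝ)⁻¹ ≤ q⁻¹ := by norm_num at h2 ⊢; linarith
    exact (inv_le_inv₀ two_pos hq0).1 h3
  obtain ⟨C, hC, hdual⟩ := exists_cauchyOp_le_of_le_two hq1 hq2
  refine ⟨C, hC, fun f hf y hy => ?_⟩
  set h : ℝ → ℂ := fun x => cauchyOp f (x + y * Complex.I) with hh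
  have hhc : Continuous h := continuous_cauchyOp_line hf.integrable hy
  have hp0' : ENNReal.ofReal p ≠ 0 := by simpa using hp0
  have hq0' : ENNReal.ofReal q ≠ 0 := by simpa using hq0
  have hpt : (ENNReal.ofReal p).toReal = p := ENNReal.toReal_ofReal hp0.le
  have hqt : (ENNReal.ofReal q).toReal = q := ENNReal.toReal_ofReal hq0.le
  have hn : ∀ n : ℕ, eLpNorm ((Icc (-(n : ℝ)) n).indicator h) (ENNReal.ofReal p) volume ≤
      ENNReal.ofReal C * eLpNorm f (ENNReal.ofReal p) volume := by
    intro n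
    set S := Icc (-(n : ℝ)) n with hS
    have hSm : MeasurableSet S := measurableSet_Icc
    -- The extremiser in Hölder's inequality for `h` on `S`. Truncating to `S` makes `N` finite, so
    -- that `N^{1/q}` can be cancelled at the end.
    set g : ℝ → ℂ := S.indicator fun x => ((‖h x‖ ^ (p - 2) : ℝ) : ℂ) * (starRingEnd ℂ) (h x)
      with hg
    have hgcont : Continuous fun x => ((‖h x‖ ^ (p - 2) : ℝ) : ℂ) * (starRingEnd ℂ) (h x) :=
      (Complex.continuous_ofReal.comp (hhc.norm.rpow_const fun x => .inr (by linarith))).mul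
        (Complex.continuous_conj.comp hhc)
    have hgb : IsBddComp g := by
      obtain ⟨M, hM⟩ := (isCompact_Icc (a := -(n : ℝ)) (b := n)).exists_bound_of_continuousOn
        hgcont.continuousOn
      refine isBddComp_of_bound (M := M) (R := n) (hgcont.measurable.indicator hSm) fun x => ?_
      by_cases hx : x ∈ S
      · rw [hg, indicator_of_mem hx, indicator_of_mem hx]; exact hM x hx
      · rw [hg, indicator_of_notMem hx, indicator_of_notMem hx, norm_zero]
    have hgh : ∀ x, g x * h x = ((S.indicator (fun x => ‖h x‖ ^ p) x : ℝ) : ℂ) := by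
      intro x
      by_cases hx : x ∈ S
      · rw [hg, indicator_of_mem hx, indicator_of_mem hx, mul_assoc, mul_comm _ (h x),
          Complex.mul_conj, Complex.normSq_eq_norm_sq, ← Complex.ofReal_mul]
        congr 1
        rw [← Real.rpow_natCast, ← Real.rpow_add_of_nonneg (norm_nonneg _) (by linarith)
          (by norm_num)]
        congr 1; push_cast; ring
      · rw [hg, indicator_of_notMem hx, indicator_of_notMem hx, zero_mul, Complex.ofReal_zero]
    have hgn : ∀ x, ‖g x‖ₑ ^ q = S.indicator (fun x => ‖h x‖ₑ ^ p) x := by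
      intro x
      by_cases hx : x ∈ S
      · rw [hg, indicator_of_mem hx, indicator_of_mem hx, enorm_mul, RCLike.enorm_conj]
        have h1 : ‖((‖h x‖ ^ (p - 2) : ℝ) : ℂ)‖ₑ = ‖h x‖ₑ ^ (p - 2) := by
          rw [← ofReal_norm, Complex.norm_real, Real.norm_eq_abs, abs_of_nonneg (by positivity),
            ← ofReal_norm, ENNReal.ofReal_rpow_of_nonneg (norm_nonneg _) (by linarith)]
        rw [h1]
        nth_rw 2 [← ENNReal.rpow_one ‖h x‖ₑ]
        rw [← ENNReal.rpow_add_of_nonneg _ _ (by linarith) zero_le_one, ← ENNReal.rpow_mul]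
        congr 1
        have := hpq.sub_one_mul_conj
        linear_combination this
      · rw [hg, indicator_of_notMem hx, indicator_of_notMem hx, enorm_zero,
          ENNReal.zero_rpow_of_pos hq0]
    set N := ∫⁻ x in S, ‖h x‖ₑ ^ p with hN
    have hhp : Continuous fun x => ‖h x‖ ^ p := hhc.norm.rpow_const fun x => .inr hp0.le
    have hNint : IntegrableOn (fun x => ‖h x‖ ^ p) S := hhp.integrableOn_Icc
    have hN1 : N = ENNReal.ofReal (∫ x in S, ‖h x‖ ^ p) := by
      rw [ofReal_integral_eq_lintegral_ofReal hNint (ae_of_all _ fun x => by positivity)]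
      refine lintegral_congr fun x => ?_
      rw [← ofReal_norm, ENNReal.ofReal_rpow_of_nonneg (norm_nonneg _) hp0.le]
    have hNt : N ≠ ∞ := by rw [hN1]; exact ENNReal.ofReal_ne_top
    have hgq : eLpNorm g (ENNReal.ofReal q) volume = N ^ (1 / q) := by
      rw [eLpNorm_eq_lintegral_rpow_enorm_toReal hq0' ENNReal.ofReal_ne_top, hqt]
      simp_rw [hgn]
      rw [lintegral_indicator hSm]
    have hhN : eLpNorm (S.indicator h) (ENNReal.ofReal p) volume = N ^ (1 / p) := by
      rw [eLpNorm_indicator_eq_eLpNorm_restrict hSm,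
        eLpNorm_eq_lintegral_rpow_enorm_toReal hp0' ENNReal.ofReal_ne_top, hpt]
    have hgr : IsBddComp (fun v => g (-v)) :=
      ⟨hgb.measurable.comp measurable_neg, hgb.bounded.imp fun _ h x => h _,
        hgb.compact.comp_homeomorph (Homeomorph.neg ℝ)⟩
    have hTg : Continuous fun s : ℝ => cauchyOp (fun v => g (-v)) (s + y * Complex.I) :=
      continuous_cauchyOp_line hgr.integrable hy
    have hTq : eLpNorm (fun t : ℝ => cauchyOp (fun v => g (-v)) ((-t : ℝ) + y * Complex.I))
        (ENNReal.ofReal q) volume ≤ ENNReal.ofReal C * N ^ (1 / q) := by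
      have e1 := eLpNorm_comp_measurePreserving (p := ENNReal.ofReal q) hTg.aestronglyMeasurable
        (Measure.measurePreserving_neg (volume : Measure ℝ))
      have e2 := eLpNorm_comp_measurePreserving (p := ENNReal.ofReal q)
        hgb.measurable.aestronglyMeasurable (Measure.measurePreserving_neg (volume : Measure ℝ))
      refine (le_of_eq e1).trans ((hdual _ hgr y hy).trans ?_)
      rw [← hgq, ← e2]
      rfl
    have hle : N ≤ eLpNorm f (ENNReal.ofReal p) volume * (ENNReal.ofReal C * N ^ (1 / q)) := by
      have e1 : N = ‖∫ x : ℝ, g x * h x‖ₑ := by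
        simp_rw [hgh]
        rw [integral_complex_ofReal, integral_indicator hSm, ← ofReal_norm, Complex.norm_real,
          Real.norm_eq_abs, abs_of_nonneg (integral_nonneg fun x => by positivity), hN1]
      refine (le_of_eq e1).trans ?_
      rw [hh, integral_mul_cauchyOp hf hgb hy]
      refine (enorm_integral_le_lintegral_enorm _).trans ?_
      simp only [enorm_mul]
      have hol := ENNReal.lintegral_mul_le_Lp_mul_Lq volume hpq
        (f := fun t => ‖f t‖ₑ)
        (g := fun t : ℝ => ‖cauchyOp (fun v => g (-v)) ((-t : ℝ) + y * Complex.I)‖ₑ)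
        hf.measurable.enorm.aemeasurable
        ((hTg.comp continuous_neg).measurable.enorm.aemeasurable)
      refine hol.trans ?_
      have e2 : eLpNorm f (ENNReal.ofReal p) volume = (∫⁻ t, ‖f t‖ₑ ^ p) ^ (1 / p) := by
        rw [eLpNorm_eq_lintegral_rpow_enorm_toReal hp0' ENNReal.ofReal_ne_top, hpt]
      rw [eLpNorm_eq_lintegral_rpow_enorm_toReal hq0' ENNReal.ofReal_ne_top, hqt] at hTq
      rw [e2]
      gcongr
    rw [hhN]
    rcases eq_or_ne N 0 with hN0 | hN0
    · rw [hN0, ENNReal.zero_rpow_of_pos (by positivity)]; exact zero_le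
    have hsplit : N = N ^ (1 / p) * N ^ (1 / q) := by
      rw [← ENNReal.rpow_add _ _ hN0 hNt, one_div, one_div, hpq.inv_add_inv_eq_one,
        ENNReal.rpow_one]
    have hNq0 : N ^ (1 / q) ≠ 0 := by
      simp [ENNReal.rpow_eq_zero_iff, hN0, hNt]
    have hNqt : N ^ (1 / q) ≠ ∞ := ENNReal.rpow_ne_top_of_nonneg (by positivity) hNt
    rw [← ENNReal.mul_le_mul_iff_left hNq0 hNqt, ← hsplit]
    refine hle.trans (le_of_eq ?_)
    ring
  refine Lp.eLpNorm_le_of_ae_tendsto (u := atTop) (Eventually.of_forall hn)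
    (fun n => hhc.aestronglyMeasurable.indicator measurableSet_Icc) (ae_of_all _ fun x => ?_)
  refine tendsto_const_nhds.congr' ?_
  obtain ⟨n₀, hn₀⟩ := exists_nat_ge |x|
  filter_upwards [eventually_ge_atTop n₀] with n hnn
  have h1 : |x| ≤ n := hn₀.trans (by exact_mod_cast hnn)
  rw [indicator_of_mem (show x ∈ Icc (-(n : ℝ)) n from abs_le.1 h1)]

/-- The theorem of M. Riesz, for the Cauchy transform on horizontal lines. -/
theorem exists_cauchyOp_le {p : ℝ≥0∞} (hp : 1 < p) (hp' : p < ∞) :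
    ∃ C : ℝ, 0 ≤ C ∧ ∀ f : ℝ → ℂ, Continuous f → Integrable f → ∀ y : ℝ, 0 < y →
      eLpNorm (fun x : ℝ => cauchyOp f (x + y * Complex.I)) p volume ≤
        ENNReal.ofReal C * eLpNorm f p volume := by
  have hpr : ENNReal.ofReal p.toReal = p := ENNReal.ofReal_toReal hp'.ne
  have hp1 : 1 < p.toReal := by
    have := (ENNReal.toReal_lt_toReal ENNReal.one_ne_top hp'.ne).2 hp
    simpa using this
  have hbase : ∃ C : ℝ, 0 ≤ C ∧ ∀ f : ℝ → ℂ, IsBddComp f → ∀ y : ℝ, 0 < y →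
      eLpNorm (fun x : ℝ => cauchyOp f (x + y * Complex.I)) p volume ≤
        ENNReal.ofReal C * eLpNorm f p volume := by
    rw [← hpr]
    rcases le_total p.toReal 2 with h | h
    · exact exists_cauchyOp_le_of_le_two hp1 h
    · exact exists_cauchyOp_le_of_two_le h
  obtain ⟨C, hC, hb⟩ := hbase
  refine ⟨C, hC, fun f hf hfi y hy => ?_⟩
  have hm : ∀ n : ℕ, Measurable ((Icc (-(n : ℝ)) n).indicator f) := fun n =>
    hf.measurable.indicator measurableSet_Icc
  have hfn : ∀ n : ℕ, IsBddComp ((Icc (-(n : ℝ)) n).indicator f) := by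
    intro n
    obtain ⟨M, hM⟩ := (isCompact_Icc (a := -(n : ℝ)) (b := n)).exists_bound_of_continuousOn
      hf.continuousOn
    refine isBddComp_of_bound (M := M) (R := n) (hm n) fun x => ?_
    by_cases hx : x ∈ Icc (-(n : ℝ)) n
    · rw [indicator_of_mem hx, indicator_of_mem hx]; exact hM x hx
    · rw [indicator_of_notMem hx, indicator_of_notMem hx, norm_zero]
  -- Fatou's lemma along truncations to `[-n, n]` removes the compact support.
  refine Lp.eLpNorm_le_of_ae_tendsto (u := atTop)
    (f := fun (n : ℕ) (x : ℝ) => cauchyOp ((Icc (-(n : ℝ)) n).indicator f) (x + y * Complex.I))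
    (Eventually.of_forall fun n => ?_)
    (fun n => (continuous_cauchyOp_line (hfn n).integrable hy).aestronglyMeasurable)
    (ae_of_all _ fun x => ?_)
  · refine (hb _ (hfn n) y hy).trans ?_
    gcongr
    exact eLpNorm_indicator_le _
  · have hx : 0 < ((x : ℂ) + y * Complex.I).im := by simpa using hy
    refine tendsto_integral_of_dominated_convergence
      (fun t : ℝ => ‖f t * (Complex.I / ((x : ℂ) + y * Complex.I - t))‖) (fun n => ?_)
      (integrable_cauchy hfi hx).norm (fun n => ae_of_all _ fun t => ?_) (ae_of_all _ fun t => ?_)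
    · exact (hm n).aestronglyMeasurable.mul (Measurable.aestronglyMeasurable (by fun_prop))
    · rw [norm_mul, norm_mul]
      gcongr
      exact norm_indicator_le_norm_self _ _
    · refine Tendsto.mul_const _ (tendsto_const_nhds.congr' ?_)
      obtain ⟨n₀, hn₀⟩ := exists_nat_ge |t|
      filter_upwards [eventually_ge_atTop n₀] with n hnn
      have h1 : |t| ≤ n := hn₀.trans (by exact_mod_cast hnn)
      rw [indicator_of_mem (show t ∈ Icc (-(n : ℝ)) n from abs_le.1 h1)]

/-! ### Restriction of the frequencies to an interval -/

theorem integral_Ioi_damped_ee (a x t : ℝ) {y : ℝ} (hy : 0 < y) :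
    ∫ ξ in Ioi a, (Real.exp (-(2 * Real.pi * y * (ξ - a))) : ℂ) * ee (ξ * (x - t)) =
      ee (a * (x - t)) * (((2 * Real.pi : ℝ) : ℂ)⁻¹ *
        (Complex.I / ((x : ℂ) + y * Complex.I - t))) := by
  have hpi := Real.pi_pos
  set c : ℂ := 2 * Real.pi * (Complex.I * ((x : ℂ) + y * Complex.I - t)) with hc
  have hcre : c.re < 0 := by
    have : c.re = -(2 * Real.pi * y) := by
      simp [hc]
    rw [this]
    have : 0 < 2 * Real.pi * y := by positivity
    linarith
  have h0 : (x : ℂ) + y * Complex.I - t ≠ 0 := by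
    intro h
    rw [hc, h] at hcre
    simp at hcre
  have hI : Complex.I * Complex.I = -1 := Complex.I_mul_I
  have e : ∀ ξ : ℝ, (Real.exp (-(2 * Real.pi * y * (ξ - a))) : ℂ) * ee (ξ * (x - t)) =
      Complex.exp (2 * Real.pi * y * a) * Complex.exp (c * ξ) := by
    intro ξ
    rw [ee, Complex.ofReal_exp, ← Complex.exp_add, ← Complex.exp_add]
    congr 1
    rw [hc]
    push_cast
    linear_combination (-2 * Real.pi * y * ξ : ℂ) * hI
  simp_rw [e]
  rw [integral_const_mul, integral_exp_mul_complex_Ioi hcre, mul_div_assoc', mul_neg,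
    ← Complex.exp_add]
  have e2 : Complex.exp (2 * Real.pi * y * a + c * a) = ee (a * (x - t)) := by
    rw [ee]
    congr 1
    rw [hc]
    push_cast
    linear_combination (2 * Real.pi * y * a : ℂ) * hI
  have hpi0 : (Real.pi : ℂ) ≠ 0 := by exact_mod_cast hpi.ne'
  rw [e2, hc]
  push_cast
  have hI0 : Complex.I ≠ 0 := Complex.I_ne_zero
  generalize (x : ℂ) + y * Complex.I - t = W at h0 ⊢
  field_simp
  rw [Complex.I_sq, mul_neg_one]

/-- Damping by `e^{-2πy(ξ-a)}` makes Fubini legitimate and moves the evaluation point from `x` to `x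
+ iy`; the modulation carries the endpoint `a` to `0`. -/
theorem damped_halfLine_eq {f : ℝ → ℂ} (hf : Integrable f) (a x : ℝ) {y : ℝ} (hy : 0 < y) :
    ∫ ξ in Ioi a, (Real.exp (-(2 * Real.pi * y * (ξ - a))) : ℂ) * (𝓕 f ξ * ee (ξ * x)) =
      ((2 * Real.pi : ℝ) : ℂ)⁻¹ * (ee (a * x) *
        cauchyOp (fun t => f t * ee (-(a * t))) (x + y * Complex.I)) := by
  have hpi := Real.pi_pos
  have hexp : IntegrableOn (fun ξ : ℝ => (Real.exp (-(2 * Real.pi * y * (ξ - a))) : ℂ)) (Ioi a) := by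
    have h1 : IntegrableOn (fun ξ : ℝ => Real.exp (-(2 * Real.pi * y) * ξ)) (Ioi a) :=
      integrableOn_exp_mul_Ioi (neg_lt_zero.2 (by positivity)) a
    have h2 : IntegrableOn (fun ξ : ℝ => Real.exp (-(2 * Real.pi * y * (ξ - a)))) (Ioi a) := by
      have := h1.const_mul (Real.exp (2 * Real.pi * y * a))
      refine this.congr (ae_of_all _ fun ξ => ?_)
      simp only [← Real.exp_add]
      congr 1; ring
    exact h2.ofReal
  have hi : Integrable (fun q : ℝ × ℝ => (Real.exp (-(2 * Real.pi * y * (q.1 - a))) : ℂ) * f q.2 *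
      ee (q.1 * (x - q.2))) ((volume.restrict (Ioi a)).prod volume) :=
    (hexp.integrable.mul_prod hf).mul_bdd (c := 1) (by fun_prop) (ae_of_all _ fun q => by simp)
  calc ∫ ξ in Ioi a, (Real.exp (-(2 * Real.pi * y * (ξ - a))) : ℂ) * (𝓕 f ξ * ee (ξ * x))
      = ∫ ξ in Ioi a, ∫ t : ℝ, (Real.exp (-(2 * Real.pi * y * (ξ - a))) : ℂ) * f t *
          ee (ξ * (x - t)) := by
        congr 1; ext ξ
        rw [fourier_apply, ← integral_mul_const, ← integral_const_mul]
        congr 1; ext t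
        have : ξ * (x - t) = -(t * ξ) + ξ * x := by ring
        rw [this, ee_add]; ring
    _ = ∫ t : ℝ, ∫ ξ in Ioi a, (Real.exp (-(2 * Real.pi * y * (ξ - a))) : ℂ) * f t *
          ee (ξ * (x - t)) := integral_integral_swap hi
    _ = _ := by
        rw [cauchyOp, ← integral_const_mul, ← integral_const_mul]
        congr 1; ext t
        have h1 : ∀ ξ : ℝ, (Real.exp (-(2 * Real.pi * y * (ξ - a))) : ℂ) * f t * ee (ξ * (x - t)) =
            f t * ((Real.exp (-(2 * Real.pi * y * (ξ - a))) : ℂ) * ee (ξ * (x - t))) := by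
          intro ξ; ring
        simp_rw [h1]
        rw [integral_const_mul, integral_Ioi_damped_ee a x t hy]
        have : a * (x - t) = a * x + -(a * t) := by ring
        rw [this, ee_add]
        ring

/-- The damped cut-offs are bounded uniformly in the height and in `a`; the height tends to zero and
Fatou's lemma applies. -/
theorem exists_halfLine_le {p : ℝ≥0∞} (hp : 1 < p) (hp' : p < ∞) :
    ∃ C : ℝ, 0 ≤ C ∧ ∀ f : 𝓢(ℝ, ℂ), IsBandLimited f → ∀ a : ℝ,
      eLpNorm (𝓕⁻ ((Ioi a).indicator (𝓕 (f : ℝ → ℂ)))) p volume ≤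
        ENNReal.ofReal C * eLpNorm (f : ℝ → ℂ) p volume := by
  obtain ⟨C, hC, hb⟩ := exists_cauchyOp_le hp hp'
  have hpi := Real.pi_pos
  refine ⟨(2 * Real.pi)⁻¹ * C, by positivity, fun f hf a => ?_⟩
  have hFi := hf.isBddComp.integrable
  set F := 𝓕 (f : ℝ → ℂ) with hF
  let ε : ℕ → ℝ := fun n => 1 / ((n : ℝ) + 1)
  have hε : ∀ n, 0 < ε n := fun n => by positivity
  have hε0 : Tendsto ε atTop (𝓝 0) := tendsto_one_div_add_atTop_nhds_zero_nat
  have hfa : Continuous fun t => f t * ee (-(a * t)) := f.continuous.mul (by fun_prop)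
  have hfai : Integrable fun t => f t * ee (-(a * t)) :=
    f.integrable.mul_bdd (c := 1) (by fun_prop) (ae_of_all _ fun t => by simp)
  refine Lp.eLpNorm_le_of_ae_tendsto (u := atTop) (f := fun (n : ℕ) (x : ℝ) =>
    ∫ ξ in Ioi a, (Real.exp (-(2 * Real.pi * ε n * (ξ - a))) : ℂ) * (F ξ * ee (ξ * x)))
    (Eventually.of_forall fun n => ?_) (fun n => ?_) (ae_of_all _ fun x => ?_)
  · have h1 := hb _ hfa hfai (ε n) (hε n)
    have h2 : eLpNorm (fun t => f t * ee (-(a * t))) p volume = eLpNorm (f : ℝ → ℂ) p volume :=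
      eLpNorm_congr_norm_ae (ae_of_all _ fun t => by simp)
    rw [h2] at h1
    have h3 : (fun x : ℝ =>
        ∫ ξ in Ioi a, (Real.exp (-(2 * Real.pi * ε n * (ξ - a))) : ℂ) * (F ξ * ee (ξ * x))) =
        ((2 * Real.pi : ℝ) : ℂ)⁻¹ • fun x : ℝ => ee (a * x) *
          cauchyOp (fun t => f t * ee (-(a * t))) (x + ε n * Complex.I) := by
      ext x
      rw [hF, damped_halfLine_eq f.integrable a x (hε n), Pi.smul_apply, smul_eq_mul]
    rw [h3, eLpNorm_const_smul]
    have h4 : eLpNorm (fun x : ℝ => ee (a * x) *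
        cauchyOp (fun t => f t * ee (-(a * t))) (x + ε n * Complex.I)) p volume =
        eLpNorm (fun x : ℝ => cauchyOp (fun t => f t * ee (-(a * t))) (x + ε n * Complex.I))
          p volume :=
      eLpNorm_congr_norm_ae (ae_of_all _ fun t => by simp)
    rw [h4, ENNReal.ofReal_mul (by positivity), mul_assoc, ← ofReal_norm, norm_inv,
      Complex.norm_real, Real.norm_eq_abs, abs_of_pos (by positivity)]
    gcongr
  · have h3 : (fun x : ℝ =>
        ∫ ξ in Ioi a, (Real.exp (-(2 * Real.pi * ε n * (ξ - a))) : ℂ) * (F ξ * ee (ξ * x))) =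
        fun x : ℝ => ((2 * Real.pi : ℝ) : ℂ)⁻¹ * (ee (a * x) *
          cauchyOp (fun t => f t * ee (-(a * t))) (x + ε n * Complex.I)) := by
      ext x
      rw [hF, damped_halfLine_eq f.integrable a x (hε n)]
    rw [h3]
    have := continuous_cauchyOp_line hfai (hε n)
    exact Continuous.aestronglyMeasurable (by fun_prop)
  · have h1 : 𝓕⁻ ((Ioi a).indicator F) x = ∫ ξ in Ioi a, F ξ * ee (ξ * x) := by
      rw [fourierInv_apply, ← integral_indicator measurableSet_Ioi]
      congr 1; ext ξ
      by_cases hξ : ξ ∈ Ioi a <;> simp [hξ]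
    rw [h1]
    refine tendsto_integral_of_dominated_convergence (fun ξ => ‖F ξ‖) (fun n => ?_)
      hFi.norm.integrableOn (fun n => ?_) (ae_of_all _ fun ξ => ?_)
    · exact AEStronglyMeasurable.mul (by fun_prop)
        (hFi.aestronglyMeasurable.restrict.mul (by fun_prop))
    · filter_upwards [ae_restrict_mem measurableSet_Ioi] with ξ hξ
      have hξ' : 0 ≤ ξ - a := sub_nonneg.2 (le_of_lt hξ)
      rw [norm_mul, norm_mul, norm_ee, mul_one, Complex.norm_real, Real.norm_eq_abs, Real.abs_exp]
      refine mul_le_of_le_one_left (norm_nonneg _) (Real.exp_le_one_iff.2 ?_)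
      have := (hε n).le
      have : 0 ≤ 2 * Real.pi * ε n * (ξ - a) := by positivity
      linarith
    · have h2 : Tendsto (fun n => Real.exp (-(2 * Real.pi * ε n * (ξ - a)))) atTop (𝓝 1) := by
        have h3 : Continuous fun s : ℝ => Real.exp (-(2 * Real.pi * s * (ξ - a))) := by fun_prop
        have := (h3.tendsto 0).comp hε0
        simpa [Function.comp_def] using this
      have h4 := ((Complex.continuous_ofReal.tendsto 1).comp h2).mul_const (F ξ * ee (ξ * x))
      simpa using h4

theorem exists_interval_le {p : ℝ≥0∞} (hp : 1 < p) (hp' : p < ∞) :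
    ∃ C : ℝ, 0 < C ∧ ∀ f : 𝓢(ℝ, ℂ), IsBandLimited f → ∀ a b : ℝ,
      eLpNorm (𝓕⁻ ((Icc a b).indicator (𝓕 (f : ℝ → ℂ)))) p volume ≤
        ENNReal.ofReal C * eLpNorm (f : ℝ → ℂ) p volume := by
  obtain ⟨C, hC, hb⟩ := exists_halfLine_le hp hp'
  -- One `C` for each half-line; the `+ 1` makes the constant positive.
  refine ⟨2 * C + 1, by linarith, fun f hf a b => ?_⟩
  have hFi := hf.isBddComp.integrable
  set F := 𝓕 (f : ℝ → ℂ) with hF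
  rcases le_or_gt a b with hab | hab
  · have hi : ∀ c, Integrable ((Ioi c).indicator F) := fun c => hFi.indicator measurableSet_Ioi
    have h1 : 𝓕⁻ ((Icc a b).indicator F) =
        𝓕⁻ ((Ioi a).indicator F) - 𝓕⁻ ((Ioi b).indicator F) := by
      ext x
      rw [Pi.sub_apply, fourierInv_apply, fourierInv_apply, fourierInv_apply, ← integral_sub]
      · refine integral_congr_ae ?_
        -- The closed interval and the difference of open half-lines disagree only at `a`.
        have hne : ∀ᵐ ξ : ℝ, ξ ≠ a := by simp [ae_iff]
        filter_upwards [hne] with ξ hξ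
        rcases lt_or_gt_of_ne hξ with h | h
        · have : ¬ b < ξ := by linarith
          simp [indicator, this, h.not_gt, h.not_ge]
        · by_cases h2 : ξ ≤ b
          · simp [indicator, h, h.le, h2, h2.not_gt]
          · simp [indicator, h, h2, not_le.1 h2]
      · exact (hi a).mul_bdd (c := 1) (by fun_prop) (ae_of_all _ fun t => by simp)
      · exact (hi b).mul_bdd (c := 1) (by fun_prop) (ae_of_all _ fun t => by simp)
    rw [h1]
    refine (eLpNorm_sub_le (continuous_fourierInv (hi a)).aestronglyMeasurable
      (continuous_fourierInv (hi b)).aestronglyMeasurable hp.le).trans ?_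
    refine (add_le_add (hb f hf a) (hb f hf b)).trans ?_
    rw [← add_mul, ← ENNReal.ofReal_add hC hC]
    gcongr ENNReal.ofReal ?_ * _
    linarith
  · have h1 : 𝓕⁻ ((Icc a b).indicator F) = 0 := by
      ext x
      rw [Icc_eq_empty hab.not_ge, fourierInv_apply]
      simp
    rw [h1]
    simp

theorem multiplier_rectangle {p₁ p₂ p₃ : ℝ≥0∞} {m : ℝ × ℝ → ℂ}
    (hm : IsBilinearMultiplier p₁ p₂ p₃ m) {C D : ℝ} (hC : 0 < C) (hD : 0 < D)
    (h₁ : ∀ f : 𝓢(ℝ, ℂ), IsBandLimited f → ∀ a b : ℝ,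
      eLpNorm (𝓕⁻ ((Icc a b).indicator (𝓕 (f : ℝ → ℂ)))) p₁ volume ≤
        ENNReal.ofReal C * eLpNorm (f : ℝ → ℂ) p₁ volume)
    (h₂ : ∀ f : 𝓢(ℝ, ℂ), IsBandLimited f → ∀ a b : ℝ,
      eLpNorm (𝓕⁻ ((Icc a b).indicator (𝓕 (f : ℝ → ℂ)))) p₂ volume ≤
        ENNReal.ofReal D * eLpNorm (f : ℝ → ℂ) p₂ volume) (a b c d : ℝ) :
    IsBilinearMultiplier p₁ p₂ p₃ ((Icc a b ×ˢ Icc c d).indicator m) ∧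
      multiplierNorm p₁ p₂ p₃ ((Icc a b ×ˢ Icc c d).indicator m) ≤
        C * D * multiplierNorm p₁ p₂ p₃ m := by
  have hn := multiplierNorm_nonneg p₁ p₂ p₃ m
  refine isBilinearMultiplier_and_norm_le ?_ (by positivity) ?_
  · rw [locallyIntegrable_iff]
    intro K hK
    exact (hm.1.integrableOn_isCompact hK).indicator (measurableSet_Icc.prod measurableSet_Icc)
  intro f g hf hg
  have hcut : ∀ {G : ℝ → ℂ}, IsBddComp G → ∀ a b, IsBddComp ((Icc a b).indicator G) :=
    fun hG a b => hG.of_norm_le (hG.measurable.indicator measurableSet_Icc)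
      fun x => norm_indicator_le_norm_self _ _
  have e : bilinearOp ((Icc a b ×ˢ Icc c d).indicator m) f g =
      freqOp m ((Icc a b).indicator (𝓕 (f : ℝ → ℂ))) ((Icc c d).indicator (𝓕 (g : ℝ → ℂ))) := by
    ext x
    rw [bilinearOp_eq, freqOp, freqOp]
    congr 1; ext z
    by_cases hz1 : z.1 ∈ Icc a b
    · by_cases hz2 : z.2 ∈ Icc c d
      · rw [indicator_of_mem hz1, indicator_of_mem hz2,
          indicator_of_mem (show z ∈ Icc a b ×ˢ Icc c d from ⟨hz1, hz2⟩)]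
      · rw [indicator_of_notMem hz2, indicator_of_notMem (fun h => hz2 h.2)]
        simp
    · rw [indicator_of_notMem hz1, indicator_of_notMem (fun h => hz1 h.1)]
      simp
  rw [e]
  refine (hm.boundedBy.freqOp_le hm.1 (hcut hf.isBddComp a b) (hcut hg.isBddComp c d)).trans ?_
  calc _ ≤ ENNReal.ofReal (multiplierNorm p₁ p₂ p₃ m) *
        (ENNReal.ofReal C * eLpNorm (f : ℝ → ℂ) p₁ volume) *
        (ENNReal.ofReal D * eLpNorm (g : ℝ → ℂ) p₂ volume) := by
        gcongr
        · exact h₁ f hf a b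
        · exact h₂ g hg c d
    _ = _ := by
        rw [ENNReal.ofReal_mul (by positivity), ENNReal.ofReal_mul hC.le]
        ring

end BilinearMultiplier

theorem mainTheorem8 (p₁ p₂ : ℝ≥0∞) (hp₁ : 1 ≤ p₁) (hp₂ : 1 ≤ p₂) :
    -- restriction to rectangles, with a constant that depends on `p₁, p₂` only
    (1 < p₁ → p₁ < ∞ → 1 < p₂ → p₂ < ∞ →
      ∃ C : ℝ, 0 < C ∧ ∀ p₃ : ℝ≥0∞, 1 ≤ p₃ →
        ∀ m : ℝ × ℝ → ℂ, IsBilinearMultiplier p₁ p₂ p₃ m → ∀ a b c d : ℝ,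
          IsBilinearMultiplier p₁ p₂ p₃ ((Icc a b ×ˢ Icc c d).indicator m) ∧
          multiplierNorm p₁ p₂ p₃ ((Icc a b ×ˢ Icc c d).indicator m) ≤
            C * multiplierNorm p₁ p₂ p₃ m) ∧
    ∀ p₃ : ℝ≥0∞, 1 ≤ p₃ → ∀ m : ℝ × ℝ → ℂ, IsBilinearMultiplier p₁ p₂ p₃ m →
      -- convolution
      (∀ Φ : ℝ × ℝ → ℂ, Integrable Φ volume →
        -- if `1/p₁ + 1/p₂ > 1/p₃`, then `|Φ| * |m|` has to be locally integrable
        (homExponent p₁ p₂ p₃ < 0 → ∀ K : Set (ℝ × ℝ), IsCompact K →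
          ∫⁻ z in K, ∫⁻ u : ℝ × ℝ, ‖Φ u‖ₑ * ‖m (z - u)‖ₑ < ∞) →
        (∀ᵐ z : ℝ × ℝ, Integrable (fun u : ℝ × ℝ => Φ u * m (z - u)) volume) ∧
        IsBilinearMultiplier p₁ p₂ p₃ (conv Φ m) ∧
        multiplierNorm p₁ p₂ p₃ (conv Φ m) ≤
          (∫ u : ℝ × ℝ, ‖Φ u‖) * multiplierNorm p₁ p₂ p₃ m) ∧
      -- multiplication by a Fourier transform
      (∀ Φ : ℝ × ℝ → ℂ, Integrable Φ volume →
        IsBilinearMultiplier p₁ p₂ p₃ (fun z => fourier₂ Φ z * m z) ∧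
        multiplierNorm p₁ p₂ p₃ (fun z => fourier₂ Φ z * m z) ≤
          (∫ u : ℝ × ℝ, ‖Φ u‖) * multiplierNorm p₁ p₂ p₃ m) ∧
      -- averages over dilations
      (∀ ψ : ℝ → ℂ,
        IntegrableOn (fun t : ℝ => ψ t * ((t ^ homExponent p₁ p₂ p₃ : ℝ) : ℂ)) (Ioi 0) volume →
        -- if `1/p₁ + 1/p₂ > 1/p₃`, then `∫_0^∞ |m(t·)| |ψ(t)| dt` has to be locally integrable
        (homExponent p₁ p₂ p₃ < 0 → ∀ K : Set (ℝ × ℝ), IsCompact K →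
          ∫⁻ z in K, ∫⁻ t in Ioi (0 : ℝ), ‖m (t * z.1, t * z.2)‖ₑ * ‖ψ t‖ₑ < ∞) →
        (∀ᵐ z : ℝ × ℝ, IntegrableOn (fun t : ℝ => m (t * z.1, t * z.2) * ψ t) (Ioi 0) volume) ∧
        IsBilinearMultiplier p₁ p₂ p₃ (dilationAverage m ψ) ∧
        multiplierNorm p₁ p₂ p₃ (dilationAverage m ψ) ≤
          (∫ t in Ioi (0 : ℝ), ‖ψ t‖ * t ^ homExponent p₁ p₂ p₃) *
            multiplierNorm p₁ p₂ p₃ m) := by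
  refine ⟨fun h1 h1' h2 h2' => ?_, fun p₃ hp₃ m hm => ⟨fun Φ hΦ hfin => ?_, fun Φ hΦ => ?_,
    fun ψ hψ hfin => ?_⟩⟩
  · obtain ⟨C, hC, hb⟩ := exists_interval_le h1 h1'
    obtain ⟨D, hD, hb'⟩ := exists_interval_le h2 h2'
    -- `C` and `D` were obtained from `p₁` and `p₂` alone, before `p₃`, `m` and the rectangle.
    exact ⟨C * D, by positivity, fun p₃ _ m hm a b c d =>
      multiplier_rectangle hm hC hD hb hb' a b c d⟩
  · exact multiplier_conv hp₃ hm hΦ hfin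
  · exact multiplier_fourier hp₃ hm hΦ
  · exact multiplier_dilationAverage hp₃ hm hψ hfin
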